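/- **Notation.** Functions on $\mathbb R$ are real- or complex-valued, $|J|$ is the length of an interval $J$, and $M_Jf=|J|^{-1}\int_J f(y)\,dy$. For $k\in\mathbb Z$ let $\mathcal I_k$ be the set of all intervals of length $2^k$ containing $0$, and let $\mathbb E_kf(x)$ be the mean of $f$ over the dyadic interval $[m2^k,(m+1)2^k)$, $m\in\mathbb Z$, that contains $x$ (the conditional expectation with respect to the $\sigma$-algebra generated by the dyadic intervals of length $2^k$). For locally integrable $f$ and $x\in\mathbb R$ put $$Sf(x)=\Big(\sum_{k\in\mathbb Z}\ \sup_{I\in\mathcal I_k}|M_{I+x}f-\mathbb E_kf(x)|^2\Big)^{1/2}\in[0,\infty].$$ For a family $\mathcal I=\{I_k(x)\}_{k\in\mathbb Z,\,x\in\mathbb R}$, where $I_k(x)$ is an arbitrary interval of length $2^k$ containing $x$, put $$S_{\mathcal I}f(x)=\Big(\sum_{k\in\mathbb Z}|M_{I_k(x)}f-\mathbb E_kf(x)|^2\Big)^{1/2}\in[0,\infty].$$ Let $L^\infty_c(\mathbb R)$ be the space of compactly supported functions in $L^\infty(\mathbb R)$, and let $BMO_d(\mathbb R)$ be the space of locally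 integrable functions $g$ with $$\|g\|_{BMO_d}=\sup_{Q\ \mathrm{dyadic}}\frac1{|Q|}\int_Q|g-M_Qg|<\infty,$$ the supremum being over all dyadic intervals $Q=[m2^k,(m+1)2^k)$, $k,m\in\mathbb Z$. **Theorem.** (1) There is a constant $C$ such that for every $f\in L^\infty_c(\mathbb R)$ the function $Sf$ is finite almost everywhere, belongs to $BMO_d(\mathbb R)$, and satisfies $\|Sf\|_{BMO_d}\le C\|f\|_{\infty}$. (2) For every $2<p<\infty$ there is a constant $C_p$ such that for every $f\in L^p(\mathbb R)$ one has $Sf\in L^p(\mathbb R)$ (in particular $Sf$ is measurable) and $\|Sf\|_p\le C_p\|f\|_p$. Moreover, for every $f\in L^p(\mathbb R)$ and every family $\mathcal I$ as above, $S_{\mathcal I}f\le Sf$ pointwise and $\|S_{\mathcal I}f\|_p\le C_p\|f\|_p$, with $C_p$ independent of $\mathcal I$. (If $S_{\mathcal I}f$ is not measurable, its norm is understood through the lower integral.) -/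

import Mathlib

open MeasureTheory Set
open scoped ENNReal NNReal

noncomputable section

/-- `J` is an interval (of any type: open, closed, half-open) of length `2 ^ k` containing `x`. -/
def IsIntervalAt (k : ℤ) (x : ℝ) (J : Set ℝ) : Prop :=
  J.OrdConnected ∧ x ∈ J ∧ volume J = ENNReal.ofReal ((2 : ℝ) ^ k)

/-- The family `𝓘ₖ` of all intervals of length `2 ^ k` containing the origin. -/
def originIntervals (k : ℤ) : Set (Set ℝ) :=
  {I | IsIntervalAt k 0 I}

/-- The translate `I + x`. -/
def translateSet (I : Set ℝ) (x : ℝ) : Set ℝ :=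
  (fun y => y + x) '' I

/-- A choice `𝓘 = {Iₖ(x)}` of an interval of length `2 ^ k` containing `x`,
for every integer `k` and every real `x`. -/
def IsIntervalFamily (I : ℤ → ℝ → Set ℝ) : Prop :=
  ∀ k x, IsIntervalAt k x (I k x)

/-- The dyadic interval `[m 2 ^ k, (m + 1) 2 ^ k)`. -/
def dyadicInterval (k m : ℤ) : Set ℝ :=
  Ico ((m : ℝ) * (2 : ℝ) ^ k) (((m : ℝ) + 1) * (2 : ℝ) ^ k)

/-- The mean value `M_J f = |J|⁻¹ ∫_J f`. -/
def intervalMean {𝕜 : Type*} [RCLike 𝕜] (J : Set ℝ) (f : ℝ → 𝕜) : 𝕜 :=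
  ⨍ y in J, f y

/-- The expectation `𝔼ₖ f` with respect to the σ-algebra generated by the dyadic intervals of
length `2 ^ k`: its value at `x` is the mean of `f` over the dyadic interval of length `2 ^ k`
that contains `x`. -/
def dyadicExpectation {𝕜 : Type*} [RCLike 𝕜] (k : ℤ) (f : ℝ → 𝕜) (x : ℝ) : 𝕜 :=
  intervalMean (dyadicInterval k ⌊x / (2 : ℝ) ^ k⌋) f

/-- `S f (x) = (∑ₖ sup_{I ∈ 𝓘ₖ} |M_{I + x} f - 𝔼ₖ f (x)|²)^{1/2}`, with values in `[0, ∞]`. -/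
def maximalSquareFunction {𝕜 : Type*} [RCLike 𝕜] (f : ℝ → 𝕜) (x : ℝ) : ℝ≥0∞ :=
  (∑' k : ℤ, ⨆ I ∈ originIntervals k,
    ‖intervalMean (translateSet I x) f - dyadicExpectation k f x‖ₑ ^ 2) ^ (1 / 2 : ℝ)

/-- `S_𝓘 f (x) = (∑ₖ |M_{Iₖ(x)} f - 𝔼ₖ f (x)|²)^{1/2}`, with values in `[0, ∞]`. -/
def familySquareFunction {𝕜 : Type*} [RCLike 𝕜] (I : ℤ → ℝ → Set ℝ) (f : ℝ → 𝕜) (x : ℝ) :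
    ℝ≥0∞ :=
  (∑' k : ℤ, ‖intervalMean (I k x) f - dyadicExpectation k f x‖ₑ ^ 2) ^ (1 / 2 : ℝ)

/-- The (semi)norm of dyadic `BMO` on the line: the supremum over all dyadic intervals `Q` of
`|Q|⁻¹ ∫_Q |g - g_Q|`, where `g_Q` is the mean of `g` over `Q`. -/
def dyadicBMONorm (g : ℝ → ℝ) : ℝ≥0∞ :=
  ⨆ (k : ℤ) (m : ℤ), (volume (dyadicInterval k m))⁻¹ *
    ∫⁻ x in dyadicInterval k m, ‖g x - intervalMean (dyadicInterval k m) g‖ₑ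

/-- Membership in dyadic `BMO` on the line. -/
def MemDyadicBMO (g : ℝ → ℝ) : Prop :=
  LocallyIntegrable g volume ∧ dyadicBMONorm g < ∞

/-- Membership in `L^∞_c(ℝ)`, the essentially bounded measurable functions with (essentially)
compact support. -/
def MemLinftyC {𝕜 : Type*} [RCLike 𝕜] (f : ℝ → 𝕜) : Prop :=
  MemLp f ∞ volume ∧ ∃ K : Set ℝ, IsCompact K ∧ ∀ᵐ x, x ∉ K → f x = 0

end

/-! Fix a scale `k`. A mean over an interval of length 2^k is a convex combination of the means over
two adjacent dyadic cells, up to an error coming from inside these cells (`exists_shifted_mean_eq`).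
So the supremum over intervals is controlled by two cell quantities (`cellOsc_sq_le`): `jump`, the
difference of neighbouring means, and `fineOsc`, the deviation of the primitive of `f` from its
chord on a cell.

Both reduce to martingale differences. The jump between the two halves of one parent is such a
difference, and these are square summable by orthogonality (`sum_tsum_even_jump_sq_le`). The jump
between cells with different parents is the parents' jump plus two differences; the chord deviation
of a parent is at most half that of a child plus one difference. In the sums of squares weighted by
cell length, both recursions contract by 3/4, one bounding the finer scale by the coarser, the other
the reverse. Absorption then gives the L² bound `sum_tsum_cellOsc_sq_le`. Scales at most that of a
dyadic interval Q see `f` only on the threefold interval, so the bound localizes to Q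
(`setLIntegral_sum_cellOsc_sq_le`).

For p > 2, put q = p/2 and order the scales from coarse to fine. Garsia–Neveu summation by parts
(`sum_rpow_le_mul_sum_tsub`) bounds the q-th power of the square sum by increments of its (q-1)-th
power times tails over finer scales. The increments are constant on cells, so the local L² bound
replaces each tail by a dyadic maximal function M of |f|². Hölder's inequality and the maximal
theorem finish.

For bounded `f` and a dyadic Q, the scales up to that of Q are handled by the local L² bound, and
the coarser ones vary by at most a multiple of the sup norm on Q, since shifting a long interval
slightly hardly changes its mean (`coarseSquare_le_add`). This gives the dyadic BMO bound. -/

namespace DyadicSquare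


/-! ### Dyadic cells and sums over their indices -/

/-- The length `2 ^ k` as an extended nonnegative real. -/
noncomputable def scale (k : ℤ) : ℝ≥0∞ := ENNReal.ofReal ((2 : ℝ) ^ k)

lemma two_zpow_pos (k : ℤ) : (0 : ℝ) < 2 ^ k := by positivity

lemma two_zpow_succ (k : ℤ) : (2 : ℝ) ^ (k + 1) = 2 * 2 ^ k := by
  rw [zpow_add_one₀ (by norm_num)]; ring

lemma scale_ne_zero (k : ℤ) : scale k ≠ 0 := by
  simp [scale, two_zpow_pos]

lemma scale_ne_top (k : ℤ) : scale k ≠ ∞ := ENNReal.ofReal_ne_top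

lemma scale_succ (k : ℤ) : scale (k + 1) = 2 * scale k := by
  rw [scale, two_zpow_succ, ENNReal.ofReal_mul (by norm_num)]; simp [scale]

lemma volume_dyadicInterval (k m : ℤ) : volume (dyadicInterval k m) = scale k := by
  rw [dyadicInterval, Real.volume_Ico, scale]; congr 1; ring

lemma measurableSet_dyadicInterval (k m : ℤ) : MeasurableSet (dyadicInterval k m) :=
  measurableSet_Ico

lemma mem_dyadicInterval_iff {k m : ℤ} {x : ℝ} :
    x ∈ dyadicInterval k m ↔ ⌊x / (2 : ℝ) ^ k⌋ = m := by
  rw [Int.floor_eq_iff, dyadicInterval, mem_Ico, le_div_iff₀ (two_zpow_pos k),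
    div_lt_iff₀ (two_zpow_pos k)]

lemma mem_dyadicInterval_floor (k : ℤ) (x : ℝ) :
    x ∈ dyadicInterval k ⌊x / (2 : ℝ) ^ k⌋ := mem_dyadicInterval_iff.2 rfl

lemma iUnion_dyadicInterval (k : ℤ) : ⋃ m, dyadicInterval k m = univ :=
  eq_univ_of_forall fun x => mem_iUnion.2 ⟨_, mem_dyadicInterval_floor k x⟩

lemma pairwise_disjoint_dyadicInterval (k : ℤ) :
    Pairwise (Function.onFun Disjoint (dyadicInterval k)) := by
  intro m n hmn
  refine Set.disjoint_left.2 fun x hx hx' => hmn ?_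
  rw [← mem_dyadicInterval_iff.1 hx, mem_dyadicInterval_iff.1 hx']

lemma lintegral_eq_tsum_dyadic (k : ℤ) (g : ℝ → ℝ≥0∞) :
    ∫⁻ x, g x = ∑' m, ∫⁻ x in dyadicInterval k m, g x := by
  rw [← lintegral_iUnion (measurableSet_dyadicInterval k) (pairwise_disjoint_dyadicInterval k),
    iUnion_dyadicInterval, setLIntegral_univ]

lemma setLIntegral_comp_floor (k m : ℤ) (g : ℤ → ℝ≥0∞) :
    ∫⁻ x in dyadicInterval k m, g ⌊x / (2 : ℝ) ^ k⌋ = scale k * g m := by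
  rw [setLIntegral_congr_fun (g := fun _ => g m) (measurableSet_dyadicInterval k m)
    fun x hx => by simp [mem_dyadicInterval_iff.1 hx], setLIntegral_const,
    volume_dyadicInterval, mul_comm]

lemma lintegral_comp_floor (k : ℤ) (g : ℤ → ℝ≥0∞) :
    ∫⁻ x : ℝ, g ⌊x / (2 : ℝ) ^ k⌋ = ∑' m, scale k * g m := by
  rw [lintegral_eq_tsum_dyadic k]
  exact tsum_congr fun m => setLIntegral_comp_floor k m g

lemma tsum_int_even_odd (g : ℤ → ℝ≥0∞) :
    ∑' m, g m = ∑' l, (g (2 * l) + g (2 * l + 1)) := by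
  rw [← (Int.divModEquiv 2).symm.tsum_eq g, ENNReal.tsum_prod']
  refine tsum_congr fun l => ?_
  rw [tsum_fintype, Fin.sum_univ_two]
  congr 2 <;> simp [Int.divModEquiv] <;> ring

lemma tsum_int_shift (g : ℤ → ℝ≥0∞) (j : ℤ) : ∑' m, g (m + j) = ∑' m, g m :=
  (Equiv.addRight j).tsum_eq g

/-! ### Cell means, jumps and oscillations -/

variable {𝕜 : Type*} [RCLike 𝕜]

/-- The mean of `f` over the dyadic interval `[m 2 ^ k, (m + 1) 2 ^ k)`. -/
noncomputable def cellMean (f : ℝ → 𝕜) (k m : ℤ) : 𝕜 :=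
  ((2 : ℝ) ^ k)⁻¹ • ∫ y in (m * (2 : ℝ) ^ k)..((m + 1) * (2 : ℝ) ^ k), f y

/-- The jump of the mean values between neighbouring dyadic intervals. -/
noncomputable def jump (f : ℝ → 𝕜) (k m : ℤ) : ℝ≥0∞ :=
  ‖cellMean f k (m + 1) - cellMean f k m‖ₑ

/-- The normalized maximal deviation of the primitive of `f` from its linear interpolation on a
dyadic interval. -/
noncomputable def fineOsc (f : ℝ → 𝕜) (k m : ℤ) : ℝ≥0∞ :=
  ⨆ t ∈ Icc (m * (2 : ℝ) ^ k) ((m + 1) * (2 : ℝ) ^ k),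
    ‖((2 : ℝ) ^ k)⁻¹ • ((∫ y in (m * (2 : ℝ) ^ k)..t, f y) -
      (t - m * (2 : ℝ) ^ k) • cellMean f k m)‖ₑ

/-- The maximal deviation, from the mean over a dyadic interval, of the means over intervals of the
same length that meet its closure. -/
noncomputable def cellOsc (f : ℝ → 𝕜) (k m : ℤ) : ℝ≥0∞ :=
  ⨆ s ∈ Icc ((m - 1) * (2 : ℝ) ^ k) ((m + 1) * (2 : ℝ) ^ k),
    ‖((2 : ℝ) ^ k)⁻¹ • (∫ y in s..(s + (2 : ℝ) ^ k), f y) - cellMean f k m‖ₑ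

lemma integral_cell (f : ℝ → 𝕜) (k m : ℤ) :
    ∫ y in (m * (2 : ℝ) ^ k)..((m + 1) * (2 : ℝ) ^ k), f y = (2 : ℝ) ^ k • cellMean f k m := by
  rw [cellMean, smul_inv_smul₀ (two_zpow_pos k).ne']

lemma cellMean_succ {f : ℝ → 𝕜} (hf : ∀ a b, IntervalIntegrable f volume a b) (k l : ℤ) :
    cellMean f (k + 1) l = (1 / 2 : ℝ) • (cellMean f k (2 * l) + cellMean f k (2 * l + 1)) := by
  have h := two_zpow_pos k
  have e1 := integral_cell f k (2 * l)
  have e2 := integral_cell f k (2 * l + 1)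
  have e3 := integral_cell f (k + 1) l
  have a1 : ((2 * l : ℤ) : ℝ) * 2 ^ k = l * 2 ^ (k + 1) := by
    rw [two_zpow_succ]; push_cast; ring
  have a2 : (((2 * l : ℤ) : ℝ) + 1) * 2 ^ k = ((2 * l + 1 : ℤ) : ℝ) * 2 ^ k := by push_cast; ring
  have a3 : (((2 * l + 1 : ℤ) : ℝ) + 1) * 2 ^ k = (l + 1) * 2 ^ (k + 1) := by
    rw [two_zpow_succ]; push_cast; ring
  rw [a1, a2] at e1
  rw [a3] at e2
  rw [← intervalIntegral.integral_add_adjacent_intervals (hf _ _) (hf _ _), e1, e2, ← smul_add,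
    two_zpow_succ] at e3
  have : (2 : ℝ) ^ k • (cellMean f k (2 * l) + cellMean f k (2 * l + 1)) =
      (2 : ℝ) ^ k • ((2 : ℝ) • cellMean f (k + 1) l) := by rw [e3, smul_smul, mul_comm]
  rw [smul_right_injective _ h.ne' this, smul_smul]; norm_num

lemma enorm_sq_eq (z : 𝕜) : ‖z‖ₑ ^ 2 = ENNReal.ofReal (‖z‖ ^ 2) := by
  rw [← ofReal_norm, ENNReal.ofReal_pow (norm_nonneg _)]

/-- The parallelogram law: the energy lost in passing to the parent is exactly that of the jump at
its midpoint. Telescoping over scales gives Bessel's inequality. -/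
lemma scale_mul_cellMean_add {f : ℝ → 𝕜} (hf : ∀ a b, IntervalIntegrable f volume a b) (k l : ℤ) :
    scale k * ‖cellMean f k (2 * l)‖ₑ ^ 2 + scale k * ‖cellMean f k (2 * l + 1)‖ₑ ^ 2 =
      scale (k + 1) * ‖cellMean f (k + 1) l‖ₑ ^ 2 + 2⁻¹ * (scale k * jump f k (2 * l) ^ 2) := by
  have h := two_zpow_pos k
  have hp := parallelogram_law_with_norm 𝕜 (cellMean f k (2 * l + 1)) (cellMean f k (2 * l))
  have h2 : (2 : ℝ≥0∞)⁻¹ = ENNReal.ofReal (1 / 2) := by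
    rw [one_div, ENNReal.ofReal_inv_of_pos (by norm_num)]; simp
  simp only [jump, enorm_sq_eq, scale, h2]
  rw [cellMean_succ hf, norm_smul, add_comm (cellMean f k (2 * l)),
    ← ENNReal.ofReal_mul h.le, ← ENNReal.ofReal_mul h.le, ← ENNReal.ofReal_mul (by positivity),
    ← ENNReal.ofReal_mul h.le, ← ENNReal.ofReal_mul (by norm_num),
    ← ENNReal.ofReal_add (by positivity) (by positivity),
    ← ENNReal.ofReal_add (by positivity) (by positivity), two_zpow_succ]
  congr 1
  have : ‖(1 / 2 : ℝ)‖ = 1 / 2 := by norm_num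
  rw [this]
  linear_combination (-(2:ℝ) ^ k / 2) * hp


/-! ### Power mean and Cauchy–Schwarz bounds -/

/-- The power mean inequality for integrals. -/
lemma rpow_lintegral_le {α : Type*} [MeasurableSpace α] {μ : Measure α} {q : ℝ} (hq : 1 < q)
    {g : α → ℝ≥0∞} (hg : AEMeasurable g μ) :
    (∫⁻ x, g x ∂μ) ^ q ≤ μ univ ^ (q - 1) * ∫⁻ x, g x ^ q ∂μ := by
  have hc := Real.HolderConjugate.conjExponent hq
  have h := ENNReal.lintegral_mul_le_Lp_mul_Lq μ hc hg (aemeasurable_const (b := (1 : ℝ≥0∞)))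
  simp only [Pi.mul_apply, mul_one, ENNReal.one_rpow, lintegral_const, one_mul] at h
  refine (ENNReal.rpow_le_rpow h (by linarith)).trans ?_
  rw [ENNReal.mul_rpow_of_nonneg _ _ (by linarith), ← ENNReal.rpow_mul, ← ENNReal.rpow_mul,
    one_div_mul_cancel (by linarith), ENNReal.rpow_one, mul_comm]
  refine le_of_eq (congrArg₂ _ (congrArg _ ?_) rfl)
  rw [Real.conjExponent]
  have : q - 1 ≠ 0 := by linarith
  field_simp

lemma sq_lintegral_le {α : Type*} [MeasurableSpace α] {μ : Measure α}
    {g : α → ℝ≥0∞} (hg : AEMeasurable g μ) :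
    (∫⁻ x, g x ∂μ) ^ 2 ≤ μ univ * ∫⁻ x, g x ^ 2 ∂μ := by
  have := rpow_lintegral_le (q := 2) (by norm_num) hg
  norm_num at this
  exact_mod_cast this

lemma aemeasurable_enorm_restrict {f : ℝ → 𝕜} (hf : ∀ a b, IntervalIntegrable f volume a b)
    (a b : ℝ) : AEMeasurable (fun x => ‖f x‖ₑ) (volume.restrict (Ico a b)) := by
  rw [restrict_Ico_eq_restrict_Ioc]
  exact (hf a b).1.aestronglyMeasurable.enorm

lemma enorm_integral_le_setLIntegral (f : ℝ → 𝕜) {a b : ℝ} (hab : a ≤ b) :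
    ‖∫ y in a..b, f y‖ₑ ≤ ∫⁻ y in Ico a b, ‖f y‖ₑ := by
  rw [intervalIntegral.integral_of_le hab, restrict_Ico_eq_restrict_Ioc]
  exact enorm_integral_le_lintegral_enorm _

lemma enorm_integral_sq_le {f : ℝ → 𝕜} (hf : ∀ a b, IntervalIntegrable f volume a b) {a b : ℝ}
    (hab : a ≤ b) :
    ‖∫ y in a..b, f y‖ₑ ^ 2 ≤ ENNReal.ofReal (b - a) * ∫⁻ y in Ico a b, ‖f y‖ₑ ^ 2 := by
  refine (pow_le_pow_left' (enorm_integral_le_setLIntegral f hab) 2).trans ?_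
  refine (sq_lintegral_le (aemeasurable_enorm_restrict hf a b)).trans_eq ?_
  rw [Measure.restrict_apply_univ, Real.volume_Ico]

lemma enorm_smul_le_of_abs_le {r c : ℝ} (h : |r| ≤ c) (z : 𝕜) :
    ‖r • z‖ₑ ≤ ENNReal.ofReal c * ‖z‖ₑ := by
  rw [enorm_smul]
  gcongr
  rw [← ofReal_norm]
  exact ENNReal.ofReal_le_ofReal h

lemma enorm_smul_le_of_abs_le_one {r : ℝ} (h : |r| ≤ 1) (z : 𝕜) : ‖r • z‖ₑ ≤ ‖z‖ₑ := by
  simpa using enorm_smul_le_of_abs_le h z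

lemma scale_mul_inv_sq (k : ℤ) (z : 𝕜) :
    scale k * ‖((2 : ℝ) ^ k)⁻¹ • z‖ₑ ^ 2 = (scale k)⁻¹ * ‖z‖ₑ ^ 2 := by
  have h : ‖((2 : ℝ) ^ k)⁻¹‖ₑ = (scale k)⁻¹ := by
    rw [← ofReal_norm, Real.norm_of_nonneg (by positivity),
      ENNReal.ofReal_inv_of_pos (two_zpow_pos k), scale]
  rw [enorm_smul, h, mul_pow, ← mul_assoc, sq (scale k)⁻¹, ← mul_assoc,
    ENNReal.mul_inv_cancel (scale_ne_zero k) (scale_ne_top k), one_mul]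

lemma scale_mul_cellMean_sq_le {f : ℝ → 𝕜} (hf : ∀ a b, IntervalIntegrable f volume a b)
    (k m : ℤ) :
    scale k * ‖cellMean f k m‖ₑ ^ 2 ≤ ∫⁻ y in dyadicInterval k m, ‖f y‖ₑ ^ 2 := by
  have h := two_zpow_pos k
  rw [cellMean, scale_mul_inv_sq]
  refine (mul_le_mul_right (enorm_integral_sq_le hf (by nlinarith)) _).trans_eq ?_
  rw [show ((m : ℝ) + 1) * 2 ^ k - m * 2 ^ k = 2 ^ k by ring, ← mul_assoc, ← scale,
    ENNReal.inv_mul_cancel (scale_ne_zero k) (scale_ne_top k), one_mul, dyadicInterval]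

/-! ### Recursions between consecutive scales -/

lemma two_mul_add_sq_le (a b : ℝ≥0∞) : 2 * (a + b) ^ 2 ≤ 3 * a ^ 2 + 6 * b ^ 2 := by
  induction a with
  | top => simp
  | coe a =>
    induction b with
    | top => simp
    | coe b =>
      norm_cast
      rw [← NNReal.coe_le_coe]
      push_cast
      nlinarith [sq_nonneg ((a : ℝ) - 2 * b)]

lemma add_sq_le (a b : ℝ≥0∞) : (a + b) ^ 2 ≤ 2 * a ^ 2 + 2 * b ^ 2 := by
  induction a with
  | top => simp
  | coe a =>
    induction b with
    | top => simp
    | coe b =>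
      norm_cast
      rw [← NNReal.coe_le_coe]
      push_cast
      nlinarith [sq_nonneg ((a : ℝ) - b)]

lemma add_add_sq_le (a b c : ℝ≥0∞) : (a + b + c) ^ 2 ≤ 3 * (a ^ 2 + b ^ 2 + c ^ 2) := by
  induction a with
  | top => simp
  | coe a =>
    induction b with
    | top => simp
    | coe b =>
      induction c with
      | top => simp
      | coe c =>
        norm_cast
        rw [← NNReal.coe_le_coe]
        push_cast
        nlinarith [sq_nonneg ((a : ℝ) - b), sq_nonneg ((a : ℝ) - c), sq_nonneg ((b : ℝ) - c)]

/-- The cells `2 * l + 1` and `2 * l + 2` have different parents, so their jump is not a martingale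
difference. It is the jump of the parents, corrected by half the jump inside each of them. -/
lemma jump_odd_le {f : ℝ → 𝕜} (hf : ∀ a b, IntervalIntegrable f volume a b) (k l : ℤ) :
    2 * jump f k (2 * l + 1) ≤
      2 * jump f (k + 1) l + (jump f k (2 * l) + jump f k (2 * (l + 1))) := by
  have h2 : ∀ z : 𝕜, 2 * ‖z‖ₑ = ‖(2 : ℝ) • z‖ₑ := fun z => by
    rw [enorm_smul, Real.enorm_eq_ofReal (by norm_num)]; simp
  simp only [jump, h2]
  rw [cellMean_succ hf, cellMean_succ hf]
  refine le_trans (le_of_eq ?_) (enorm_sub_le.trans (add_le_add_right (enorm_add_le _ _) _))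
  rw [show 2 * l + 1 + 1 = 2 * (l + 1) by ring]
  congr 1
  module

lemma two_mul_jump_odd_sq_le {f : ℝ → 𝕜} (hf : ∀ a b, IntervalIntegrable f volume a b)
    (k l : ℤ) : 2 * jump f k (2 * l + 1) ^ 2 ≤
      3 * jump f (k + 1) l ^ 2 + 3 * (jump f k (2 * l) ^ 2 + jump f k (2 * (l + 1)) ^ 2) := by
  have h := pow_le_pow_left' (jump_odd_le hf k l) 2
  -- The weights 3/2 and 3 matter: the symmetric bound with weights 2 and 2 would leave a recursion
  -- with factor 1 once cell lengths are included, and nothing could be absorbed.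
  have h1 := two_mul_add_sq_le (2 * jump f (k + 1) l) (jump f k (2 * l) + jump f k (2 * (l + 1)))
  have h2 := add_sq_le (jump f k (2 * l)) (jump f k (2 * (l + 1)))
  refine (ENNReal.mul_le_mul_iff_right (a := 4) (by norm_num) (by norm_num)).1 ?_
  calc 4 * (2 * jump f k (2 * l + 1) ^ 2) = 2 * (2 * jump f k (2 * l + 1)) ^ 2 := by ring
    _ ≤ _ := (mul_le_mul_right h 2).trans h1
    _ ≤ 3 * (2 * jump f (k + 1) l) ^ 2 + 6 * (2 * jump f k (2 * l) ^ 2 +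
        2 * jump f k (2 * (l + 1)) ^ 2) := by gcongr
    _ = _ := by ring

/-- The primitive minus its chord on the parent is the same object on a child plus a tent vanishing
at both ends. Normalizing by the parent's length halves the first part and makes the tent's peak, at
the midpoint, a quarter of the jump. -/
lemma fineOsc_succ_le {f : ℝ → 𝕜} (hf : ∀ a b, IntervalIntegrable f volume a b) (k l : ℤ) :
    4 * fineOsc f (k + 1) l ≤
      2 * max (fineOsc f k (2 * l)) (fineOsc f k (2 * l + 1)) + jump f k (2 * l) := by
  have h := two_zpow_pos k
  have h4 : ∀ z : 𝕜, 4 * ‖z‖ₑ = ‖(4 : ℝ) • z‖ₑ := fun z => by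
    rw [enorm_smul, Real.enorm_eq_ofReal (by norm_num)]; simp
  have h2 : ∀ z : 𝕜, 2 * ‖z‖ₑ = ‖(2 : ℝ) • z‖ₑ := fun z => by
    rw [enorm_smul, Real.enorm_eq_ofReal (by norm_num)]; simp
  simp only [fineOsc, ENNReal.mul_iSup]
  refine iSup₂_le fun t ht => ?_
  rw [two_zpow_succ] at ht ⊢
  rw [cellMean_succ hf, h4, jump]
  rcases le_total t ((2 * l + 1) * 2 ^ k) with hl | hl
  · have key : ‖(2 : ℝ) • (((2 : ℝ) ^ k)⁻¹ • ((∫ y in (((2 * l : ℤ) : ℝ) * (2 : ℝ) ^ k)..t, f y) -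
        (t - ((2 * l : ℤ) : ℝ) * (2 : ℝ) ^ k) • cellMean f k (2 * l)))‖ₑ ≤
        2 * fineOsc f k (2 * l) := by
      rw [← h2]
      gcongr
      refine le_iSup₂_of_le t ⟨?_, ?_⟩ le_rfl
      · push_cast; linarith [ht.1]
      · push_cast; linarith
    refine le_trans ?_ (add_le_add (key.trans (mul_le_mul_right (le_max_left _ _) 2))
      (enorm_smul_le_of_abs_le_one (r := -((t - 2 * l * 2 ^ k) * ((2 : ℝ) ^ k)⁻¹)) ?_ _))
    · refine le_trans (le_of_eq ?_) (enorm_add_le _ _)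
      rw [show (l : ℝ) * (2 * 2 ^ k) = ((2 * l : ℤ) : ℝ) * 2 ^ k by push_cast; ring]
      congr 1
      push_cast
      module
    · rw [abs_neg, abs_of_nonneg (mul_nonneg (by linarith [ht.1]) (by positivity)),
        ← div_eq_mul_inv, div_le_one h]
      linarith
  · have key : ‖(2 : ℝ) • (((2 : ℝ) ^ k)⁻¹ • ((∫ y in (((2 * l + 1 : ℤ) : ℝ) * (2 : ℝ) ^ k)..t,
        f y) - (t - ((2 * l + 1 : ℤ) : ℝ) * (2 : ℝ) ^ k) • cellMean f k (2 * l + 1)))‖ₑ ≤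
        2 * fineOsc f k (2 * l + 1) := by
      rw [← h2]
      gcongr
      refine le_iSup₂_of_le t ⟨?_, ?_⟩ le_rfl
      · push_cast; linarith
      · push_cast; linarith [ht.2]
    -- On the right half the tent descends to the right endpoint, so its weight is the distance to
    -- that endpoint.
    refine le_trans ?_ (add_le_add (key.trans (mul_le_mul_right (le_max_right _ _) 2))
      (enorm_smul_le_of_abs_le_one (r := -(((2 * l + 2) * 2 ^ k - t) * ((2 : ℝ) ^ k)⁻¹)) ?_ _))
    · refine le_trans (le_of_eq ?_) (enorm_add_le _ _)
      have hc := integral_cell f k (2 * l)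
      rw [show (((2 * l : ℤ) : ℝ) + 1) * 2 ^ k = ((2 * l + 1 : ℤ) : ℝ) * 2 ^ k by push_cast; ring]
        at hc
      rw [show (l : ℝ) * (2 * 2 ^ k) = ((2 * l : ℤ) : ℝ) * 2 ^ k by push_cast; ring,
        ← intervalIntegral.integral_add_adjacent_intervals (hf _ (((2 * l + 1 : ℤ) : ℝ) * 2 ^ k))
          (hf _ _), hc]
      congr 1
      push_cast
      match_scalars <;> field_simp <;> ring
    · rw [abs_neg, abs_of_nonneg (mul_nonneg (by linarith [ht.2]) (by positivity)),
        ← div_eq_mul_inv, div_le_one h]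
      linarith

lemma fineOsc_succ_sq_le {f : ℝ → 𝕜} (hf : ∀ a b, IntervalIntegrable f volume a b) (k l : ℤ) :
    16 * fineOsc f (k + 1) l ^ 2 ≤
      6 * (fineOsc f k (2 * l) ^ 2 + fineOsc f k (2 * l + 1) ^ 2) + 3 * jump f k (2 * l) ^ 2 := by
  have h := pow_le_pow_left' (fineOsc_succ_le hf k l) 2
  set a := fineOsc f k (2 * l)
  set b := fineOsc f k (2 * l + 1)
  have h1 := two_mul_add_sq_le (2 * max a b) (jump f k (2 * l))
  have h2 : max a b ^ 2 ≤ a ^ 2 + b ^ 2 := by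
    rcases le_total a b with h | h <;> simp [h]
  refine (ENNReal.mul_le_mul_iff_right (a := 2) (by norm_num) (by norm_num)).1 ?_
  calc 2 * (16 * fineOsc f (k + 1) l ^ 2) = 2 * (4 * fineOsc f (k + 1) l) ^ 2 := by ring
    _ ≤ _ := (mul_le_mul_right h 2).trans h1
    _ = 12 * max a b ^ 2 + 6 * jump f k (2 * l) ^ 2 := by ring
    _ ≤ 12 * (a ^ 2 + b ^ 2) + 6 * jump f k (2 * l) ^ 2 := by gcongr
    _ = _ := by ring

/-- A mean over an interval inside two adjacent dyadic intervals is, up to the fine oscillations, a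
convex combination of the two means. -/
lemma exists_shifted_mean_eq {f : ℝ → 𝕜} (hf : ∀ a b, IntervalIntegrable f volume a b) (k j : ℤ)
    {s : ℝ} (hs : s ∈ Icc (j * (2 : ℝ) ^ k) ((j + 1) * (2 : ℝ) ^ k)) :
    ∃ θ ∈ Icc (0 : ℝ) 1, ∃ u v : 𝕜, ‖u‖ₑ ≤ fineOsc f k j ∧ ‖v‖ₑ ≤ fineOsc f k (j + 1) ∧
      ((2 : ℝ) ^ k)⁻¹ • (∫ y in s..(s + (2 : ℝ) ^ k), f y) =
        cellMean f k j + θ • (cellMean f k (j + 1) - cellMean f k j) + (v - u) := by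
  have h := two_zpow_pos k
  obtain ⟨h1, h2⟩ := hs
  refine ⟨(s - j * 2 ^ k) * ((2 : ℝ) ^ k)⁻¹, ⟨mul_nonneg (by linarith) (by positivity), ?_⟩,
    ((2 : ℝ) ^ k)⁻¹ • ((∫ y in (j * (2 : ℝ) ^ k)..s, f y) -
      (s - j * (2 : ℝ) ^ k) • cellMean f k j),
    ((2 : ℝ) ^ k)⁻¹ • ((∫ y in (((j + 1 : ℤ) : ℝ) * (2 : ℝ) ^ k)..(s + 2 ^ k), f y) -
      (s + 2 ^ k - ((j + 1 : ℤ) : ℝ) * (2 : ℝ) ^ k) • cellMean f k (j + 1)),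
    le_iSup₂_of_le s ⟨h1, h2⟩ le_rfl, le_iSup₂_of_le (s + 2 ^ k) ⟨?_, ?_⟩ le_rfl, ?_⟩
  · rw [← div_eq_mul_inv, div_le_one h]; linarith
  · push_cast; linarith
  · push_cast; linarith
  · have hc := integral_cell f k j
    have hd : (∫ y in (j * (2 : ℝ) ^ k)..s, f y) + (∫ y in s..(s + (2 : ℝ) ^ k), f y) =
        (2 : ℝ) ^ k • cellMean f k j +
          ∫ y in (((j + 1 : ℤ) : ℝ) * (2 : ℝ) ^ k)..(s + 2 ^ k), f y := by
      rw [← hc, intervalIntegral.integral_add_adjacent_intervals (hf _ _) (hf _ _)]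
      push_cast
      rw [intervalIntegral.integral_add_adjacent_intervals (hf _ _) (hf _ _)]
    rw [← eq_sub_iff_add_eq'] at hd
    rw [hd]
    push_cast
    match_scalars <;> field_simp <;> ring

/-- An interval starting to the left of the cell is compared with the cells `m - 1, m`, one starting
inside it with `m, m + 1`; either way the jump has a coefficient of modulus at most 1. The form `m +
(-1)` suits `tsum_int_shift`. -/
lemma cellOsc_sq_le {f : ℝ → 𝕜} (hf : ∀ a b, IntervalIntegrable f volume a b) (k m : ℤ) :
    cellOsc f k m ^ 2 ≤ 3 * ((jump f k (m + (-1)) ^ 2 + jump f k m ^ 2) +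
      (fineOsc f k (m + (-1)) ^ 2 + fineOsc f k m ^ 2 + fineOsc f k (m + 1) ^ 2)) := by
  have key : cellOsc f k m ≤
      max (jump f k (m + (-1)) + fineOsc f k (m + (-1)) + fineOsc f k m)
        (jump f k m + fineOsc f k m + fineOsc f k (m + 1)) := by
    refine iSup₂_le fun s hs => ?_
    rcases le_total s (m * 2 ^ k) with hsm | hsm
    · refine le_max_of_le_left ?_
      obtain ⟨θ, hθ, u, v, hu, hv, e⟩ := exists_shifted_mean_eq hf k (m + (-1)) (s := s)
        ⟨by push_cast; linarith [hs.1], by push_cast; linarith⟩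
      rw [e]
      rw [jump]
      rw [neg_add_cancel_right] at hv ⊢
      calc _ = ‖(-(1 - θ)) • (cellMean f k m - cellMean f k (m + -1)) + (-u) + v‖ₑ := by
            congr 1; module
        _ ≤ ‖(-(1 - θ)) • (cellMean f k m - cellMean f k (m + -1))‖ₑ + ‖-u‖ₑ + ‖v‖ₑ :=
            (enorm_add_le _ _).trans (by gcongr; exact enorm_add_le _ _)
        _ ≤ _ := by
            rw [enorm_neg u]
            gcongr
            exact enorm_smul_le_of_abs_le_one
              (by rw [abs_neg, abs_le]; constructor <;> linarith [hθ.1, hθ.2]) _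
    · refine le_max_of_le_right ?_
      obtain ⟨θ, hθ, u, v, hu, hv, e⟩ := exists_shifted_mean_eq hf k m (s := s) ⟨hsm, hs.2⟩
      rw [e]
      rw [jump]
      calc _ = ‖θ • (cellMean f k (m + 1) - cellMean f k m) + (-u) + v‖ₑ := by
            congr 1; module
        _ ≤ ‖θ • (cellMean f k (m + 1) - cellMean f k m)‖ₑ + ‖-u‖ₑ + ‖v‖ₑ :=
            (enorm_add_le _ _).trans (by gcongr; exact enorm_add_le _ _)
        _ ≤ _ := by
            rw [enorm_neg u]
            gcongr
            exact enorm_smul_le_of_abs_le_one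
              (by rw [abs_le]; constructor <;> linarith [hθ.1, hθ.2]) _
  rcases le_max_iff.1 key with h | h
  · refine (pow_le_pow_left' h 2).trans ((add_add_sq_le _ _ _).trans ?_)
    rw [add_assoc]
    exact mul_le_mul_right (add_le_add le_self_add le_self_add) _
  · refine (pow_le_pow_left' h 2).trans ((add_add_sq_le _ _ _).trans ?_)
    rw [add_assoc (jump f k m ^ 2), add_assoc (fineOsc f k (m + -1) ^ 2)]
    exact mul_le_mul_right (add_le_add le_add_self le_add_self) _

lemma scale_mul_fineOsc_sq_le {f : ℝ → 𝕜} (hf : ∀ a b, IntervalIntegrable f volume a b)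
    (k m : ℤ) :
    scale k * fineOsc f k m ^ 2 ≤ 4 * ∫⁻ y in dyadicInterval k m, ‖f y‖ₑ ^ 2 := by
  have h := two_zpow_pos k
  set V := ∫⁻ y in dyadicInterval k m, ‖f y‖ₑ ^ 2 with hV
  simp only [fineOsc, ENNReal.iSup_pow_of_ne_zero two_ne_zero, ENNReal.mul_iSup]
  refine iSup₂_le fun t ht => ?_
  rw [smul_sub]
  have hc := scale_mul_cellMean_sq_le hf k m
  have h1 : scale k * ‖((2 : ℝ) ^ k)⁻¹ • ∫ y in (m * (2 : ℝ) ^ k)..t, f y‖ₑ ^ 2 ≤ V := by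
    rw [scale_mul_inv_sq]
    calc _ ≤ (scale k)⁻¹ * (scale k * V) := by
          refine mul_le_mul_right ((enorm_integral_sq_le hf ht.1).trans ?_) _
          gcongr
          · exact ENNReal.ofReal_le_ofReal (by linarith [ht.2])
          · exact lintegral_mono_set (Ico_subset_Ico_right ht.2)
      _ = V := by
          rw [← mul_assoc, ENNReal.inv_mul_cancel (scale_ne_zero k) (scale_ne_top k), one_mul]
  have h2 : ‖((2 : ℝ) ^ k)⁻¹ • (t - m * (2 : ℝ) ^ k) • cellMean f k m‖ₑ ≤ ‖cellMean f k m‖ₑ := by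
    rw [smul_smul]
    refine enorm_smul_le_of_abs_le_one ?_ _
    rw [abs_of_nonneg (mul_nonneg (by positivity) (by linarith [ht.1])), mul_comm,
      ← div_eq_mul_inv, div_le_one h]
    linarith [ht.2]
  calc _ ≤ scale k * (2 * ‖((2 : ℝ) ^ k)⁻¹ • ∫ y in (m * (2 : ℝ) ^ k)..t, f y‖ₑ ^ 2 +
        2 * ‖cellMean f k m‖ₑ ^ 2) := by
        gcongr
        refine (pow_le_pow_left' (enorm_sub_le.trans (add_le_add_right h2 _)) 2).trans ?_
        exact add_sq_le _ _
    _ = 2 * (scale k * ‖((2 : ℝ) ^ k)⁻¹ • ∫ y in (m * (2 : ℝ) ^ k)..t, f y‖ₑ ^ 2) +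
        2 * (scale k * ‖cellMean f k m‖ₑ ^ 2) := by ring
    _ ≤ 2 * V + 2 * V := by gcongr
    _ = _ := by ring


/-! ### The global L² bound -/

lemma le_of_four_mul_le {S T : ℝ≥0∞} (hS : S ≠ ∞) (h : 4 * S ≤ 3 * S + T) : S ≤ T := by
  rw [show (4 : ℝ≥0∞) * S = 3 * S + S by ring] at h
  exact (ENNReal.add_le_add_iff_left (ENNReal.mul_ne_top (by norm_num) hS)).1 h

lemma tsum_cellMean_sq_le {f : ℝ → 𝕜} (hf : ∀ a b, IntervalIntegrable f volume a b) (k : ℤ) :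
    ∑' m, scale k * ‖cellMean f k m‖ₑ ^ 2 ≤ ∫⁻ y, ‖f y‖ₑ ^ 2 := by
  rw [lintegral_eq_tsum_dyadic k]
  exact ENNReal.tsum_le_tsum fun m => scale_mul_cellMean_sq_le hf k m

lemma tsum_fineOsc_sq_le {f : ℝ → 𝕜} (hf : ∀ a b, IntervalIntegrable f volume a b) (k : ℤ) :
    ∑' m, scale k * fineOsc f k m ^ 2 ≤ 4 * ∫⁻ y, ‖f y‖ₑ ^ 2 := by
  rw [lintegral_eq_tsum_dyadic k, ← ENNReal.tsum_mul_left]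
  exact ENNReal.tsum_le_tsum fun m => scale_mul_fineOsc_sq_le hf k m

lemma tsum_jump_sq_le {f : ℝ → 𝕜} (hf : ∀ a b, IntervalIntegrable f volume a b) (k : ℤ) :
    ∑' m, scale k * jump f k m ^ 2 ≤ 4 * ∫⁻ y, ‖f y‖ₑ ^ 2 := by
  calc ∑' m, scale k * jump f k m ^ 2
      ≤ ∑' m, (2 * (scale k * ‖cellMean f k (m + 1)‖ₑ ^ 2) +
          2 * (scale k * ‖cellMean f k m‖ₑ ^ 2)) := by
        refine ENNReal.tsum_le_tsum fun m => ?_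
        calc scale k * jump f k m ^ 2
            ≤ scale k * (2 * ‖cellMean f k (m + 1)‖ₑ ^ 2 + 2 * ‖cellMean f k m‖ₑ ^ 2) := by
              gcongr
              exact (pow_le_pow_left' enorm_sub_le 2).trans (add_sq_le _ _)
          _ = _ := by ring
    _ = 4 * ∑' m, scale k * ‖cellMean f k m‖ₑ ^ 2 := by
        have hs := tsum_int_shift (fun m => ‖cellMean f k m‖ₑ ^ 2) 1
        simp only [ENNReal.tsum_add, ENNReal.tsum_mul_left, hs]
        ring
    _ ≤ _ := by gcongr; exact tsum_cellMean_sq_le hf k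

lemma tsum_cellMean_sq_eq {f : ℝ → 𝕜} (hf : ∀ a b, IntervalIntegrable f volume a b) (k : ℤ) :
    ∑' m, scale k * ‖cellMean f k m‖ₑ ^ 2 =
      ∑' m, scale (k + 1) * ‖cellMean f (k + 1) m‖ₑ ^ 2 +
        2⁻¹ * ∑' l, scale k * jump f k (2 * l) ^ 2 := by
  rw [tsum_int_even_odd, ← ENNReal.tsum_mul_left, ← ENNReal.tsum_add]
  exact tsum_congr fun l => scale_mul_cellMean_add hf k l

/-- Bessel's inequality for the martingale differences. -/
lemma sum_tsum_even_jump_sq_le {f : ℝ → 𝕜} (hf : ∀ a b, IntervalIntegrable f volume a b)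
    (a : ℤ) (n : ℕ) :
    ∑ i ∈ Finset.range n, ∑' l, scale (a + i) * jump f (a + i) (2 * l) ^ 2 ≤
      2 * ∫⁻ y, ‖f y‖ₑ ^ 2 := by
  have h : ∀ n : ℕ, ∑' m, scale a * ‖cellMean f a m‖ₑ ^ 2 =
      ∑' m, scale (a + n) * ‖cellMean f (a + n) m‖ₑ ^ 2 +
        2⁻¹ * ∑ i ∈ Finset.range n, ∑' l, scale (a + i) * jump f (a + i) (2 * l) ^ 2 := by
    intro n
    induction n with
    | zero => simp
    | succ n ih =>
      rw [ih, tsum_cellMean_sq_eq hf (a + n), Finset.sum_range_succ, mul_add, Nat.cast_succ,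
        ← add_assoc a]
      ring
  have h1 : 2⁻¹ * ∑ i ∈ Finset.range n, ∑' l, scale (a + i) * jump f (a + i) (2 * l) ^ 2 ≤
      ∫⁻ y, ‖f y‖ₑ ^ 2 := le_add_self.trans ((h n).symm.le.trans (tsum_cellMean_sq_le hf a))
  rwa [mul_comm, ← div_eq_mul_inv, ENNReal.div_le_iff_le_mul (by simp) (by simp), mul_comm] at h1

/-- The weight 3/2 on the parents' jump times the ratio 1/2 of cell lengths leaves the factor 3/4;
the even jumps are already summable. -/
lemma tsum_jump_sq_succ_le {f : ℝ → 𝕜} (hf : ∀ a b, IntervalIntegrable f volume a b) (k : ℤ) :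
    4 * ∑' m, scale k * jump f k m ^ 2 ≤
      3 * ∑' m, scale (k + 1) * jump f (k + 1) m ^ 2 +
        16 * ∑' l, scale k * jump f k (2 * l) ^ 2 := by
  have h : 4 * ∑' l, scale k * jump f k (2 * l + 1) ^ 2 ≤
      3 * ∑' m, scale (k + 1) * jump f (k + 1) m ^ 2 +
        12 * ∑' l, scale k * jump f k (2 * l) ^ 2 := by
    have hs := tsum_int_shift (fun l => jump f k (2 * l) ^ 2) 1
    calc 4 * ∑' l, scale k * jump f k (2 * l + 1) ^ 2
        ≤ ∑' l, (3 * (scale (k + 1) * jump f (k + 1) l ^ 2) +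
          6 * (scale k * jump f k (2 * l) ^ 2) + 6 * (scale k * jump f k (2 * (l + 1)) ^ 2)) := by
          rw [← ENNReal.tsum_mul_left]
          refine ENNReal.tsum_le_tsum fun l => ?_
          rw [scale_succ]
          calc 4 * (scale k * jump f k (2 * l + 1) ^ 2)
              = 2 * scale k * (2 * jump f k (2 * l + 1) ^ 2) := by ring
            _ ≤ 2 * scale k * _ := mul_le_mul_right (two_mul_jump_odd_sq_le hf k l) _
            _ = _ := by ring
      _ = _ := by
          simp only [ENNReal.tsum_add, ENNReal.tsum_mul_left, hs]
          ring
  rw [tsum_int_even_odd, ENNReal.tsum_add, mul_add]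
  calc _ ≤ 4 * ∑' l, scale k * jump f k (2 * l) ^ 2 + _ := add_le_add_right h _
    _ = _ := by ring

/-- Here the coarser scale is bounded by the finer one. The factor 3/4 is the weight 3/8 on the
children times the ratio 2 of cell lengths. -/
lemma tsum_fineOsc_sq_succ_le {f : ℝ → 𝕜} (hf : ∀ a b, IntervalIntegrable f volume a b)
    (k : ℤ) :
    4 * ∑' m, scale (k + 1) * fineOsc f (k + 1) m ^ 2 ≤
      3 * ∑' m, scale k * fineOsc f k m ^ 2 + 2 * ∑' l, scale k * jump f k (2 * l) ^ 2 := by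
  rw [tsum_int_even_odd (fun m => scale k * fineOsc f k m ^ 2), ← ENNReal.tsum_mul_left,
    ← ENNReal.tsum_mul_left, ← ENNReal.tsum_mul_left, ← ENNReal.tsum_add]
  refine ENNReal.tsum_le_tsum fun l => ?_
  rw [scale_succ]
  refine (ENNReal.mul_le_mul_iff_right (a := 2) (by norm_num) (by norm_num)).1 ?_
  calc 2 * (4 * (2 * scale k * fineOsc f (k + 1) l ^ 2))
      = scale k * (16 * fineOsc f (k + 1) l ^ 2) := by ring
    _ ≤ scale k * _ := mul_le_mul_right (fineOsc_succ_sq_le hf k l) _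
    _ = 2 * (3 * (scale k * fineOsc f k (2 * l) ^ 2 + scale k * fineOsc f k (2 * l + 1) ^ 2)) +
        3 * (scale k * jump f k (2 * l) ^ 2) := by ring
    _ ≤ 2 * (3 * (scale k * fineOsc f k (2 * l) ^ 2 + scale k * fineOsc f k (2 * l + 1) ^ 2)) +
        4 * (scale k * jump f k (2 * l) ^ 2) := by gcongr; norm_num
    _ = _ := by ring

/-- Sum the recursion and absorb 3/4 of the left side, which is finite by hypothesis. The shifted
sum adds one boundary term at the coarse end, bounded crudely by 4V, so 44 = 3·4 + 16·2. -/
lemma sum_tsum_jump_sq_le {f : ℝ → 𝕜} (hf : ∀ a b, IntervalIntegrable f volume a b)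
    (a : ℤ) (n : ℕ) (hV : ∫⁻ y, ‖f y‖ₑ ^ 2 ≠ ∞) :
    ∑ i ∈ Finset.range n, ∑' m, scale (a + i) * jump f (a + i) m ^ 2 ≤
      44 * ∫⁻ y, ‖f y‖ₑ ^ 2 := by
  set V := ∫⁻ y, ‖f y‖ₑ ^ 2
  set X : ℕ → ℝ≥0∞ := fun i => ∑' m, scale (a + i) * jump f (a + i) m ^ 2
  have hX : ∀ i, X i ≤ 4 * V := fun i => tsum_jump_sq_le hf _
  have hfin : ∑ i ∈ Finset.range n, X i ≠ ∞ := ENNReal.sum_ne_top.2 fun i _ =>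
    ((hX i).trans_lt (ENNReal.mul_lt_top (by norm_num) hV.lt_top)).ne
  refine le_of_four_mul_le hfin ?_
  calc 4 * ∑ i ∈ Finset.range n, X i
      ≤ ∑ i ∈ Finset.range n, (3 * X (i + 1) +
          16 * ∑' l, scale (a + i) * jump f (a + i) (2 * l) ^ 2) := by
        rw [Finset.mul_sum]
        refine Finset.sum_le_sum fun i _ => ?_
        simp only [X, Nat.cast_succ, ← add_assoc]
        exact tsum_jump_sq_succ_le hf _
    _ ≤ 3 * (∑ i ∈ Finset.range n, X i + 4 * V) + 16 * (2 * V) := by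
        rw [Finset.sum_add_distrib, ← Finset.mul_sum, ← Finset.mul_sum]
        gcongr
        · calc ∑ i ∈ Finset.range n, X (i + 1)
              ≤ ∑ i ∈ Finset.range (n + 1), X i := by
                rw [Finset.sum_range_succ']; exact le_self_add
            _ ≤ _ := by rw [Finset.sum_range_succ]; gcongr; exact hX n
        · exact sum_tsum_even_jump_sq_le hf a n
    _ = _ := by ring

/-- The same absorption with the boundary term at the fine end: 20 = 2·2 + 4·4. -/
lemma sum_tsum_fineOsc_sq_le {f : ℝ → 𝕜} (hf : ∀ a b, IntervalIntegrable f volume a b)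
    (a : ℤ) (n : ℕ) (hV : ∫⁻ y, ‖f y‖ₑ ^ 2 ≠ ∞) :
    ∑ i ∈ Finset.range n, ∑' m, scale (a + i) * fineOsc f (a + i) m ^ 2 ≤
      20 * ∫⁻ y, ‖f y‖ₑ ^ 2 := by
  set V := ∫⁻ y, ‖f y‖ₑ ^ 2
  set Y : ℕ → ℝ≥0∞ := fun i => ∑' m, scale (a + i) * fineOsc f (a + i) m ^ 2
  have hY : ∀ i, Y i ≤ 4 * V := fun i => tsum_fineOsc_sq_le hf _
  have hfin : ∑ i ∈ Finset.range n, Y i ≠ ∞ := ENNReal.sum_ne_top.2 fun i _ =>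
    ((hY i).trans_lt (ENNReal.mul_lt_top (by norm_num) hV.lt_top)).ne
  refine le_of_four_mul_le hfin ?_
  calc 4 * ∑ i ∈ Finset.range n, Y i
      ≤ 4 * (∑ i ∈ Finset.range n, Y (i + 1) + Y 0) := by
        rw [← Finset.sum_range_succ' , Finset.sum_range_succ]; gcongr; exact le_self_add
    _ ≤ ∑ i ∈ Finset.range n, (3 * Y i +
          2 * ∑' l, scale (a + i) * jump f (a + i) (2 * l) ^ 2) + 4 * (4 * V) := by
        rw [mul_add, Finset.mul_sum]
        gcongr with i _
        · simp only [Y, Nat.cast_succ, ← add_assoc]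
          exact tsum_fineOsc_sq_succ_le hf _
        · exact hY 0
    _ ≤ 3 * ∑ i ∈ Finset.range n, Y i + 2 * (2 * V) + 4 * (4 * V) := by
        rw [Finset.sum_add_distrib, ← Finset.mul_sum, ← Finset.mul_sum]
        gcongr
        exact sum_tsum_even_jump_sq_le hf a n
    _ = _ := by ring

/-- The square function built from the cell oscillations is bounded on `L²`. -/
lemma sum_tsum_cellOsc_sq_le {f : ℝ → 𝕜} (hf : ∀ a b, IntervalIntegrable f volume a b)
    (s : Finset ℤ) :
    ∑ k ∈ s, ∑' m, scale k * cellOsc f k m ^ 2 ≤ 444 * ∫⁻ y, ‖f y‖ₑ ^ 2 := by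
  by_cases hV : ∫⁻ y, ‖f y‖ₑ ^ 2 = ∞
  · rw [hV]; simp
  -- The recursions link consecutive scales, so `s` is enlarged to a window without gaps.
  obtain ⟨a, n, hs⟩ : ∃ (a : ℤ) (n : ℕ), s ⊆ (Finset.range n).image (fun i : ℕ => a + i) := by
    obtain ⟨b, hb⟩ := s.bddAbove
    obtain ⟨a, ha⟩ := s.bddBelow
    refine ⟨a, (b - a).toNat + 1, fun k hk => ?_⟩
    have h1 := ha hk
    have h2 := hb hk
    simp only [Finset.mem_image, Finset.mem_range]
    exact ⟨(k - a).toNat, by omega, by omega⟩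
  calc ∑ k ∈ s, ∑' m, scale k * cellOsc f k m ^ 2
      ≤ ∑ i ∈ Finset.range n, ∑' m, scale (a + i) * cellOsc f (a + i) m ^ 2 := by
        refine (Finset.sum_le_sum_of_subset hs).trans_eq ?_
        rw [Finset.sum_image (by intro i _ j _ h; simpa using h)]
    _ ≤ ∑ i ∈ Finset.range n, (6 * ∑' m, scale (a + i) * jump f (a + i) m ^ 2 +
          9 * ∑' m, scale (a + i) * fineOsc f (a + i) m ^ 2) := by
        refine Finset.sum_le_sum fun i _ => ?_
        generalize a + (i : ℤ) = k
        have h1 := tsum_int_shift (fun m => scale k * jump f k m ^ 2) (-1)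
        have h2 := tsum_int_shift (fun m => scale k * fineOsc f k m ^ 2) (-1)
        have h3 := tsum_int_shift (fun m => scale k * fineOsc f k m ^ 2) 1
        calc _ ≤ ∑' m, (3 * (scale k * jump f k (m + (-1)) ^ 2) + 3 * (scale k * jump f k m ^ 2) +
              3 * (scale k * fineOsc f k (m + (-1)) ^ 2) + 3 * (scale k * fineOsc f k m ^ 2) +
              3 * (scale k * fineOsc f k (m + 1) ^ 2)) := by
              refine ENNReal.tsum_le_tsum fun m => ?_
              calc _ ≤ scale k * _ := mul_le_mul_right (cellOsc_sq_le hf k m) _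
                _ = _ := by ring
          _ = _ := by
              simp only [ENNReal.tsum_add, ENNReal.tsum_mul_left, h1, h2, h3] at *
              ring
    _ ≤ 6 * (44 * ∫⁻ y, ‖f y‖ₑ ^ 2) + 9 * (20 * ∫⁻ y, ‖f y‖ₑ ^ 2) := by
        rw [Finset.sum_add_distrib, ← Finset.mul_sum, ← Finset.mul_sum]
        gcongr
        · exact sum_tsum_jump_sq_le hf a n hV
        · exact sum_tsum_fineOsc_sq_le hf a n hV
    _ = _ := by ring

/-! ### Localization of the L² bound -/

lemma cellOsc_congr {f g : ℝ → 𝕜} {k m : ℤ}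
    (h : EqOn f g (Icc ((m - 1) * (2 : ℝ) ^ k) ((m + 2) * (2 : ℝ) ^ k))) :
    cellOsc f k m = cellOsc g k m := by
  have hk := two_zpow_pos k
  have h1 : cellMean f k m = cellMean g k m := by
    rw [cellMean, cellMean]
    congr 1
    refine intervalIntegral.integral_congr (h.mono ?_)
    rw [uIcc_of_le (by nlinarith)]
    exact Icc_subset_Icc (by nlinarith) (by nlinarith)
  rw [cellOsc, cellOsc, h1]
  refine iSup_congr fun s => iSup_congr fun hs => ?_
  congr 3
  refine intervalIntegral.integral_congr (h.mono ?_)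
  rw [uIcc_of_le (by linarith)]
  exact Icc_subset_Icc hs.1 (by linarith [hs.2])

lemma measurable_comp_floor (k : ℤ) (g : ℤ → ℝ≥0∞) :
    Measurable fun x : ℝ => g ⌊x / (2 : ℝ) ^ k⌋ :=
  (measurable_of_countable g).comp (Int.measurable_floor.comp (measurable_id.div_const _))

lemma floor_bounds_of_mem {j l k : ℤ} (hk : k ≤ j) {x : ℝ} (hx : x ∈ dyadicInterval j l) :
    l * (2 : ℝ) ^ j ≤ ⌊x / (2 : ℝ) ^ k⌋ * (2 : ℝ) ^ k ∧
      (⌊x / (2 : ℝ) ^ k⌋ + 1) * (2 : ℝ) ^ k ≤ (l + 1) * (2 : ℝ) ^ j := by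
  have h := two_zpow_pos k
  obtain ⟨d, rfl⟩ := Int.le.dest hk
  have hd : (2 : ℝ) ^ (k + d) = ((2 ^ d : ℤ) : ℝ) * 2 ^ k := by
    rw [zpow_add₀ (by norm_num)]; push_cast; rw [zpow_natCast]; ring
  obtain ⟨h1, h2⟩ := hx
  rw [hd, ← mul_assoc] at h1 h2 ⊢
  rw [← mul_assoc]
  rw [← le_div_iff₀ h] at h1
  rw [← div_lt_iff₀ h] at h2
  constructor
  · gcongr
    exact_mod_cast Int.le_floor.2 (by exact_mod_cast h1)
  · gcongr
    exact_mod_cast Int.add_one_le_iff.2 (Int.floor_lt.2 (by exact_mod_cast h2))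

/-- The `L²` bound localizes: on a dyadic interval the finer scales only see `f` on the
threefold interval. -/
lemma setLIntegral_sum_cellOsc_sq_le {f : ℝ → 𝕜} (hf : ∀ a b, IntervalIntegrable f volume a b)
    (j l : ℤ) {s : Finset ℤ} (hs : ∀ k ∈ s, k ≤ j) :
    ∫⁻ x in dyadicInterval j l, ∑ k ∈ s, cellOsc f k ⌊x / (2 : ℝ) ^ k⌋ ^ 2 ≤
      444 * ∫⁻ y in Ico ((l - 1) * (2 : ℝ) ^ j) ((l + 2) * (2 : ℝ) ^ j), ‖f y‖ₑ ^ 2 := by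
  set I := Icc ((l - 1) * (2 : ℝ) ^ j) ((l + 2) * (2 : ℝ) ^ j) with hI
  set g := I.indicator f with hg
  have hgi : ∀ a b, IntervalIntegrable g volume a b := fun a b => by
    have := hf a b
    rw [intervalIntegrable_iff] at this ⊢
    exact this.indicator measurableSet_Icc
  calc ∫⁻ x in dyadicInterval j l, ∑ k ∈ s, cellOsc f k ⌊x / (2 : ℝ) ^ k⌋ ^ 2
      = ∫⁻ x in dyadicInterval j l, ∑ k ∈ s, cellOsc g k ⌊x / (2 : ℝ) ^ k⌋ ^ 2 := by
        refine setLIntegral_congr_fun (measurableSet_dyadicInterval j l) fun x hx => ?_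
        refine Finset.sum_congr rfl fun k hk => ?_
        rw [cellOsc_congr]
        intro y hy
        rw [hg, indicator_of_mem]
        obtain ⟨h1, h2⟩ := floor_bounds_of_mem (hs k hk) hx
        have h3 : (2 : ℝ) ^ k ≤ 2 ^ j := zpow_le_zpow_right₀ (by norm_num) (hs k hk)
        exact ⟨by nlinarith [hy.1], by nlinarith [hy.2]⟩
    _ ≤ ∫⁻ x, ∑ k ∈ s, cellOsc g k ⌊x / (2 : ℝ) ^ k⌋ ^ 2 := setLIntegral_le_lintegral _ _
    _ = ∑ k ∈ s, ∑' m, scale k * cellOsc g k m ^ 2 := by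
        rw [lintegral_finsetSum s fun k _ =>
          measurable_comp_floor k (fun m => cellOsc g k m ^ 2)]
        exact Finset.sum_congr rfl fun k _ => lintegral_comp_floor k (fun m => cellOsc g k m ^ 2)
    _ ≤ 444 * ∫⁻ y, ‖g y‖ₑ ^ 2 := sum_tsum_cellOsc_sq_le hgi s
    _ = _ := by
        rw [restrict_Ico_eq_restrict_Icc, ← hI, ← lintegral_indicator measurableSet_Icc]
        congr 2
        ext y
        rw [← hI]
        by_cases hy : y ∈ I <;> simp [hg, hy]


/-! ### The dyadic maximal function with neighbours -/

/-- Hölder's inequality followed by division by a power of the (finite) left side. -/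
lemma lintegral_rpow_le_of_le_mul {α : Type*} [MeasurableSpace α] {μ : Measure α} {q : ℝ}
    (hq : 1 < q) {F M : α → ℝ≥0∞} (hF : AEMeasurable F μ) (hM : AEMeasurable M μ)
    (hfin : ∫⁻ x, M x ^ q ∂μ ≠ ∞) {K : ℝ≥0∞}
    (h : ∫⁻ x, M x ^ q ∂μ ≤ K * ∫⁻ x, F x * M x ^ (q - 1) ∂μ) :
    ∫⁻ x, M x ^ q ∂μ ≤ K ^ q * ∫⁻ x, F x ^ q ∂μ := by
  have hq0 : 0 < q := by linarith
  set X := ∫⁻ x, M x ^ q ∂μ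
  set Y := ∫⁻ x, F x ^ q ∂μ
  have hc := Real.HolderConjugate.conjExponent hq
  have hH := ENNReal.lintegral_mul_le_Lp_mul_Lq μ hc hF (hM.pow_const (q - 1))
  have e : (q - 1) * q.conjExponent = q := by
    rw [Real.conjExponent]; field_simp [show q - 1 ≠ 0 by linarith]
  have e' : 1 / q.conjExponent = 1 - 1 / q := by
    rw [Real.conjExponent]; field_simp
  simp only [Pi.mul_apply, ← ENNReal.rpow_mul, e, e'] at hH
  rcases eq_or_ne X 0 with h0 | h0
  · rw [h0]; exact zero_le
  have h1 : X ^ (1 / q) * X ^ (1 - 1 / q) ≤ K * Y ^ (1 / q) * X ^ (1 - 1 / q) := by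
    rw [← ENNReal.rpow_add _ _ h0 hfin, add_sub_cancel, ENNReal.rpow_one, mul_assoc]
    exact h.trans (mul_le_mul_right hH K)
  have hne : X ^ (1 - 1 / q) ≠ 0 := by simp [ENNReal.rpow_eq_zero_iff, h0, hfin]
  have hne' : X ^ (1 - 1 / q) ≠ ∞ := by
    simp [ENNReal.rpow_eq_top_iff, h0, hfin]
  rw [ENNReal.mul_le_mul_iff_left hne hne'] at h1
  have h2 := ENNReal.rpow_le_rpow h1 hq0.le
  rwa [ENNReal.mul_rpow_of_nonneg _ _ hq0.le, ← ENNReal.rpow_mul, ← ENNReal.rpow_mul,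
    one_div_mul_cancel hq0.ne', ENNReal.rpow_one, ENNReal.rpow_one] at h2

/-- The mean of a nonnegative function over a dyadic interval. -/
noncomputable def cellAvg (F : ℝ → ℝ≥0∞) (k m : ℤ) : ℝ≥0∞ :=
  (scale k)⁻¹ * ∫⁻ x in dyadicInterval k m, F x

/-- The dyadic maximal function over the scales in `s`, including the neighbouring intervals. -/
noncomputable def maxAvg (F : ℝ → ℝ≥0∞) (s : Finset ℤ) (x : ℝ) : ℝ≥0∞ :=
  ⨆ p ∈ s ×ˢ ({-1, 0, 1} : Finset ℤ), cellAvg F p.1 (⌊x / (2 : ℝ) ^ p.1⌋ + p.2)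

lemma scale_mul_cellAvg (F : ℝ → ℝ≥0∞) (k m : ℤ) :
    scale k * cellAvg F k m = ∫⁻ x in dyadicInterval k m, F x := by
  rw [cellAvg, ← mul_assoc, ENNReal.mul_inv_cancel (scale_ne_zero k) (scale_ne_top k), one_mul]

lemma measurable_maxAvg (F : ℝ → ℝ≥0∞) (s : Finset ℤ) : Measurable (maxAvg F s) :=
  Measurable.biSup _ (Finset.countable_toSet _) fun p _ =>
    measurable_comp_floor p.1 (fun m => cellAvg F p.1 (m + p.2))

lemma le_maxAvg {F : ℝ → ℝ≥0∞} {s : Finset ℤ} {k c : ℤ} (hk : k ∈ s)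
    (hc : c ∈ ({-1, 0, 1} : Finset ℤ)) (x : ℝ) :
    cellAvg F k (⌊x / (2 : ℝ) ^ k⌋ + c) ≤ maxAvg F s x :=
  le_iSup₂_of_le (k, c) (Finset.mem_product.2 ⟨hk, hc⟩) le_rfl

lemma lintegral_comp_floor_mul_cellAvg {F : ℝ → ℝ≥0∞} (hF : AEMeasurable F) (k : ℤ)
    (γ : ℤ → ℝ≥0∞) :
    ∫⁻ x : ℝ, γ ⌊x / (2 : ℝ) ^ k⌋ * cellAvg F k ⌊x / (2 : ℝ) ^ k⌋ =
      ∫⁻ x : ℝ, γ ⌊x / (2 : ℝ) ^ k⌋ * F x := by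
  rw [lintegral_comp_floor k (fun m => γ m * cellAvg F k m), lintegral_eq_tsum_dyadic k]
  refine tsum_congr fun m => ?_
  rw [setLIntegral_congr_fun (g := fun x => γ m * F x) (measurableSet_dyadicInterval k m)
    fun x hx => by simp [mem_dyadicInterval_iff.1 hx], lintegral_const_mul'' _ hF.restrict,
    ← scale_mul_cellAvg]
  ring

lemma scale_mul_cellAvg_rpow_le {F : ℝ → ℝ≥0∞} (hF : AEMeasurable F) {q : ℝ} (hq : 1 < q)
    (k m : ℤ) :
    scale k * cellAvg F k m ^ q ≤ ∫⁻ x in dyadicInterval k m, F x ^ q := by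
  have h := rpow_lintegral_le hq (hF.restrict (s := dyadicInterval k m))
  rw [Measure.restrict_apply_univ, volume_dyadicInterval, ← scale_mul_cellAvg,
    ENNReal.mul_rpow_of_nonneg _ _ (by linarith)] at h
  have e : scale k ^ q = scale k ^ (q - 1) * scale k := by
    conv_rhs => rw [← ENNReal.rpow_one (scale k), ← ENNReal.rpow_mul, one_mul]
    rw [← ENNReal.rpow_add _ _ (scale_ne_zero k) (scale_ne_top k), sub_add_cancel]
  rw [e, mul_assoc, ENNReal.mul_le_mul_iff_right] at h
  · exact h
  · simp [ENNReal.rpow_eq_zero_iff, scale_ne_zero, scale_ne_top]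
  · simp [ENNReal.rpow_eq_top_iff, scale_ne_zero, scale_ne_top]

lemma cellAvg_ne_top {F : ℝ → ℝ≥0∞} (hF : AEMeasurable F) {q : ℝ} (hq : 1 < q)
    (hfin : ∫⁻ x, F x ^ q ≠ ∞) (k m : ℤ) : cellAvg F k m ≠ ∞ := by
  intro h
  have := (scale_mul_cellAvg_rpow_le hF hq k m).trans (setLIntegral_le_lintegral _ _)
  rw [h, ENNReal.top_rpow_of_pos (by linarith), ENNReal.mul_top (scale_ne_zero k)] at this
  exact hfin (top_le_iff.1 this)

lemma lintegral_cellAvg_rpow_le {F : ℝ → ℝ≥0∞} (hF : AEMeasurable F) {q : ℝ} (hq : 1 < q)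
    (k c : ℤ) :
    ∫⁻ x : ℝ, cellAvg F k (⌊x / (2 : ℝ) ^ k⌋ + c) ^ q ≤ ∫⁻ x, F x ^ q := by
  rw [lintegral_comp_floor k (fun m => cellAvg F k (m + c) ^ q),
    tsum_int_shift (fun m => scale k * cellAvg F k m ^ q) c, lintegral_eq_tsum_dyadic k]
  exact ENNReal.tsum_le_tsum fun m => scale_mul_cellAvg_rpow_le hF hq k m

lemma maxAvg_rpow_le_sum (F : ℝ → ℝ≥0∞) (s : Finset ℤ) {q : ℝ} (hq : 0 < q) (x : ℝ) :
    maxAvg F s x ^ q ≤ ∑ p ∈ s ×ˢ ({-1, 0, 1} : Finset ℤ),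
      cellAvg F p.1 (⌊x / (2 : ℝ) ^ p.1⌋ + p.2) ^ q := by
  rw [← ENNReal.le_rpow_inv_iff hq]
  refine iSup₂_le fun p hp => ?_
  rw [ENNReal.le_rpow_inv_iff hq]
  exact Finset.single_le_sum (f := fun p : ℤ × ℤ =>
    cellAvg F p.1 (⌊x / (2 : ℝ) ^ p.1⌋ + p.2) ^ q) (fun _ _ => zero_le) hp

/-- With finitely many scales, the sum dominates the supremum. The bound is qualitative; it licenses
the division in `lintegral_rpow_le_of_le_mul`. -/
lemma lintegral_maxAvg_rpow_ne_top {F : ℝ → ℝ≥0∞} (hF : AEMeasurable F) {q : ℝ} (hq : 1 < q)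
    (hfin : ∫⁻ x, F x ^ q ≠ ∞) (s : Finset ℤ) : ∫⁻ x, maxAvg F s x ^ q ≠ ∞ := by
  refine ((lintegral_mono (maxAvg_rpow_le_sum F s (by linarith))).trans_lt ?_).ne
  rw [lintegral_finsetSum _ fun p _ =>
    measurable_comp_floor p.1 (fun m => cellAvg F p.1 (m + p.2) ^ q)]
  exact ENNReal.sum_lt_top.2 fun p _ =>
    (lintegral_cellAvg_rpow_le hF hq p.1 p.2).trans_lt hfin.lt_top

lemma maxAvg_ne_top {F : ℝ → ℝ≥0∞} (hF : AEMeasurable F) {q : ℝ} (hq : 1 < q)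
    (hfin : ∫⁻ x, F x ^ q ≠ ∞) (s : Finset ℤ) (x : ℝ) : maxAvg F s x ≠ ∞ := by
  have h := maxAvg_rpow_le_sum F s one_pos x
  simp only [ENNReal.rpow_one] at h
  exact (h.trans_lt (ENNReal.sum_lt_top.2 fun p _ => (cellAvg_ne_top hF hq hfin _ _).lt_top)).ne

lemma floor_eq_floor_of_le {k j : ℤ} (hk : k ≤ j) {x y : ℝ}
    (h : ⌊x / (2 : ℝ) ^ k⌋ = ⌊y / (2 : ℝ) ^ k⌋) : ⌊x / (2 : ℝ) ^ j⌋ = ⌊y / (2 : ℝ) ^ j⌋ := by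
  have h1 := floor_bounds_of_mem hk (mem_dyadicInterval_floor j x)
  have h2 := mem_dyadicInterval_floor k y
  rw [h] at h1
  exact (mem_dyadicInterval_iff.1 ⟨h1.1.trans h2.1, h2.2.trans_le h1.2⟩).symm

/-- The points whose coarsest dyadic mean above the level `t` is the one of scale `k`. -/
def stopSet (F : ℝ → ℝ≥0∞) (s : Finset ℤ) (t : ℝ≥0∞) (k : ℤ) : Set ℝ :=
  {x | t < cellAvg F k ⌊x / (2 : ℝ) ^ k⌋ ∧
    ∀ j ∈ s, k < j → cellAvg F j ⌊x / (2 : ℝ) ^ j⌋ ≤ t}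

lemma mem_stopSet_congr {F : ℝ → ℝ≥0∞} {s : Finset ℤ} {t : ℝ≥0∞} {k : ℤ} {x y : ℝ}
    (h : ⌊x / (2 : ℝ) ^ k⌋ = ⌊y / (2 : ℝ) ^ k⌋) :
    x ∈ stopSet F s t k ↔ y ∈ stopSet F s t k := by
  simp only [stopSet, mem_ofPred_eq, h]
  refine and_congr_right fun _ => forall_congr' fun j => forall_congr' fun _ =>
    forall_congr' fun hj => ?_
  rw [floor_eq_floor_of_le hj.le h]

lemma exists_mem_stopSet {F : ℝ → ℝ≥0∞} {s : Finset ℤ} {t : ℝ≥0∞} {k : ℤ} (hk : k ∈ s) {x : ℝ}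
    (h : t < cellAvg F k ⌊x / (2 : ℝ) ^ k⌋) : ∃ j ∈ s, k ≤ j ∧ x ∈ stopSet F s t j := by
  classical
  set S := s.filter fun j => t < cellAvg F j ⌊x / (2 : ℝ) ^ j⌋
  have hkS : k ∈ S := Finset.mem_filter.2 ⟨hk, h⟩
  refine ⟨S.max' ⟨k, hkS⟩, ?_, S.le_max' _ hkS, ?_, fun j hj hlt => ?_⟩
  · exact (Finset.mem_filter.1 (S.max'_mem ⟨k, hkS⟩)).1
  · exact (Finset.mem_filter.1 (S.max'_mem ⟨k, hkS⟩)).2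
  · by_contra hcon
    exact absurd (S.le_max' j (Finset.mem_filter.2 ⟨hj, not_le.1 hcon⟩)) (not_le.2 hlt)

/-- The characteristic function of `stopSet` as a function of the dyadic index. -/
noncomputable def stopIndicator (F : ℝ → ℝ≥0∞) (s : Finset ℤ) (t : ℝ≥0∞) (k m : ℤ) : ℝ≥0∞ :=
  (stopSet F s t k).indicator 1 (m * (2 : ℝ) ^ k)

lemma stopIndicator_of_mem_dyadicInterval {F : ℝ → ℝ≥0∞} {s : Finset ℤ} {t : ℝ≥0∞} {k m : ℤ}
    {x : ℝ} (hx : x ∈ dyadicInterval k m) :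
    stopIndicator F s t k m = (stopSet F s t k).indicator 1 x := by
  have h : ⌊(m * (2 : ℝ) ^ k) / (2 : ℝ) ^ k⌋ = ⌊x / (2 : ℝ) ^ k⌋ := by
    rw [mul_div_cancel_right₀ _ (two_zpow_pos k).ne', Int.floor_intCast,
      mem_dyadicInterval_iff.1 hx]
  by_cases hm : x ∈ stopSet F s t k
  · rw [stopIndicator, indicator_of_mem hm, indicator_of_mem ((mem_stopSet_congr h).2 hm)]; rfl
  · rw [stopIndicator, indicator_of_notMem hm,
      indicator_of_notMem (fun h' => hm ((mem_stopSet_congr h).1 h'))]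

/-- Shift `x` by `c * 2 ^ k` into the neighbour with large mean. The shifted point lies in a
stopping cell of some scale `j ≥ k`, and a shift by at most 2^j crosses at most one boundary at
scale `j`. Hence stopping cells and their neighbours cover the superlevel set. -/
lemma indicator_maxAvg_le (F : ℝ → ℝ≥0∞) (s : Finset ℤ) (t : ℝ≥0∞) (x : ℝ) :
    {x | t < maxAvg F s x}.indicator 1 x ≤ ∑ p ∈ s ×ˢ ({-1, 0, 1} : Finset ℤ),
      stopIndicator F s t p.1 (⌊x / (2 : ℝ) ^ p.1⌋ + p.2) := by
  by_cases hx : t < maxAvg F s x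
  swap
  · rw [indicator_of_notMem (s := {x | t < maxAvg F s x}) hx]; exact zero_le
  rw [indicator_of_mem (show x ∈ {x | t < maxAvg F s x} from hx)]
  simp only [maxAvg, lt_iSup_iff] at hx
  obtain ⟨⟨k, c⟩, hp, hx⟩ := hx
  obtain ⟨hk, hc⟩ := Finset.mem_product.1 hp
  dsimp only at hk hc hx
  have h2k := two_zpow_pos k
  set y := x + c * 2 ^ k with hy
  have hyk : ⌊y / (2 : ℝ) ^ k⌋ = ⌊x / (2 : ℝ) ^ k⌋ + c := by
    rw [hy, add_div, mul_div_cancel_right₀ _ h2k.ne', Int.floor_add_intCast]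
  rw [← hyk] at hx
  obtain ⟨j, hj, hkj, hys⟩ := exists_mem_stopSet hk hx
  have h2j := two_zpow_pos j
  have hle : (2 : ℝ) ^ k ≤ 2 ^ j := zpow_le_zpow_right₀ (by norm_num) hkj
  have hc1 : |(c : ℝ)| ≤ 1 := by
    simp only [Finset.mem_insert, Finset.mem_singleton] at hc
    rcases hc with rfl | rfl | rfl <;> simp
  have hdist : |y / (2 : ℝ) ^ j - x / (2 : ℝ) ^ j| ≤ 1 := by
    rw [← sub_div, hy, add_sub_cancel_left, abs_div, abs_of_pos h2j, div_le_one h2j, abs_mul,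
      abs_of_pos h2k]
    nlinarith
  have hcj : ⌊y / (2 : ℝ) ^ j⌋ - ⌊x / (2 : ℝ) ^ j⌋ ∈ ({-1, 0, 1} : Finset ℤ) := by
    have h1 := Int.floor_le (y / (2 : ℝ) ^ j)
    have h2 := Int.lt_floor_add_one (y / (2 : ℝ) ^ j)
    have h3 := Int.floor_le (x / (2 : ℝ) ^ j)
    have h4 := Int.lt_floor_add_one (x / (2 : ℝ) ^ j)
    rw [abs_le] at hdist
    have h5 : (⌊y / (2 : ℝ) ^ j⌋ : ℝ) < ⌊x / (2 : ℝ) ^ j⌋ + 2 := by linarith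
    have h6 : (⌊x / (2 : ℝ) ^ j⌋ : ℝ) < ⌊y / (2 : ℝ) ^ j⌋ + 2 := by linarith
    norm_cast at h5 h6
    simp only [Finset.mem_insert, Finset.mem_singleton]
    omega
  refine le_trans (le_of_eq ?_) (Finset.single_le_sum
    (f := fun p : ℤ × ℤ => stopIndicator F s t p.1 (⌊x / (2 : ℝ) ^ p.1⌋ + p.2))
    (fun _ _ => zero_le) (Finset.mem_product (p := (j, _)).2 ⟨hj, hcj⟩))
  dsimp only
  rw [add_sub_cancel, stopIndicator_of_mem_dyadicInterval (mem_dyadicInterval_floor j y),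
    indicator_of_mem hys]
  rfl

/-- Each point stops at most at one scale, the coarsest with a large mean, and a stopping cell lies
in the superlevel set through the offset 0. -/
lemma sum_stopIndicator_le (F : ℝ → ℝ≥0∞) (s : Finset ℤ) (t : ℝ≥0∞) (x : ℝ) :
    ∑ k ∈ s, stopIndicator F s t k ⌊x / (2 : ℝ) ^ k⌋ ≤
      {x | t < maxAvg F s x}.indicator 1 x := by
  simp only [fun k => stopIndicator_of_mem_dyadicInterval (F := F) (s := s) (t := t)
    (mem_dyadicInterval_floor k x)]
  by_cases h : ∃ k ∈ s, x ∈ stopSet F s t k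
  · obtain ⟨k, hk, hx⟩ := h
    rw [Finset.sum_eq_single k, indicator_of_mem hx, indicator_of_mem]
    · refine hx.1.trans_le ?_
      simpa using le_maxAvg (F := F) hk (c := 0) (by simp) x
    · intro j hj hjk
      refine indicator_of_notMem (fun hxj => ?_) _
      rcases lt_or_gt_of_ne hjk with h | h
      · exact absurd (hxj.2 k hk h) (not_le.2 hx.1)
      · exact absurd (hx.2 j hj h) (not_le.2 hxj.1)
    · exact fun h => absurd hk h
  · push Not at h
    rw [Finset.sum_eq_zero fun k hk => indicator_of_notMem (h k hk) _]
    exact zero_le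

/-- The weak type inequality for the dyadic maximal function with neighbours. -/
lemma mul_volume_maxAvg_le {F : ℝ → ℝ≥0∞} (hF : AEMeasurable F) (s : Finset ℤ) (t : ℝ≥0∞) :
    t * volume {x | t < maxAvg F s x} ≤ 3 * ∫⁻ x in {x | t < maxAvg F s x}, F x := by
  have hm : MeasurableSet {x | t < maxAvg F s x} :=
    measurableSet_lt measurable_const (measurable_maxAvg F s)
  have h1 : volume {x | t < maxAvg F s x} ≤
      3 * ∑ k ∈ s, ∑' m, scale k * stopIndicator F s t k m := by
    rw [← lintegral_indicator_one hm]
    refine (lintegral_mono (indicator_maxAvg_le F s t)).trans_eq ?_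
    rw [lintegral_finsetSum _ fun p _ =>
      measurable_comp_floor p.1 (fun m => stopIndicator F s t p.1 (m + p.2)),
      Finset.sum_product, Finset.mul_sum]
    refine Finset.sum_congr rfl fun k _ => ?_
    simp only [fun c => lintegral_comp_floor k (fun m => stopIndicator F s t k (m + c)),
      fun c => tsum_int_shift (fun m => scale k * stopIndicator F s t k m) c]
    rw [Finset.sum_const]
    simp
  have h2 : ∀ k, t * ∑' m, scale k * stopIndicator F s t k m ≤
      ∫⁻ x : ℝ, stopIndicator F s t k ⌊x / (2 : ℝ) ^ k⌋ * F x := by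
    intro k
    rw [← lintegral_comp_floor_mul_cellAvg hF, ← lintegral_comp_floor k (stopIndicator F s t k),
      ← lintegral_const_mul _ (measurable_comp_floor k _)]
    refine lintegral_mono fun x => ?_
    rw [mul_comm, stopIndicator_of_mem_dyadicInterval (mem_dyadicInterval_floor k x)]
    by_cases hx : x ∈ stopSet F s t k
    · rw [indicator_of_mem hx]; gcongr; exact hx.1.le
    · simp [hx]
  calc t * volume {x | t < maxAvg F s x}
      ≤ 3 * ∑ k ∈ s, t * ∑' m, scale k * stopIndicator F s t k m := by
        rw [← Finset.mul_sum, mul_left_comm]; gcongr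
    _ ≤ 3 * ∑ k ∈ s, ∫⁻ x : ℝ, stopIndicator F s t k ⌊x / (2 : ℝ) ^ k⌋ * F x := by
        gcongr with k _; exact h2 k
    _ = 3 * ∫⁻ x : ℝ, (∑ k ∈ s, stopIndicator F s t k ⌊x / (2 : ℝ) ^ k⌋) * F x := by
        simp only [Finset.sum_mul]
        have hmf : ∀ k ∈ s, AEMeasurable
            (fun x : ℝ => stopIndicator F s t k ⌊x / (2 : ℝ) ^ k⌋ * F x) volume := fun k _ =>
          (measurable_comp_floor k (stopIndicator F s t k)).aemeasurable.mul hF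
        rw [lintegral_finsetSum' _ hmf]
    _ ≤ 3 * ∫⁻ x : ℝ, {x | t < maxAvg F s x}.indicator 1 x * F x := by
        gcongr with x; exact sum_stopIndicator_le F s t x
    _ = _ := by
        rw [← lintegral_indicator hm]
        congr 2
        ext x
        by_cases hx : x ∈ {x | t < maxAvg F s x} <;> simp only [indicator, hx] <;> simp

/-- The strong type inequality for the dyadic maximal function with neighbours. -/
lemma lintegral_maxAvg_rpow_le {F : ℝ → ℝ≥0∞} (hF : AEMeasurable F) {q : ℝ} (hq : 1 < q)
    (hfin : ∫⁻ x, F x ^ q ≠ ∞) (s : Finset ℤ) :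
    ∫⁻ x, maxAvg F s x ^ q ≤
      (3 * ENNReal.ofReal q / ENNReal.ofReal (q - 1)) ^ q * ∫⁻ x, F x ^ q := by
  have hM := measurable_maxAvg F s
  have htop := maxAvg_ne_top hF hq hfin s
  refine lintegral_rpow_le_of_le_mul hq hF hM.aemeasurable
    (lintegral_maxAvg_rpow_ne_top hF hq hfin s) ?_
  set g : ℝ → ℝ := fun x => (maxAvg F s x).toReal with hg
  have hpow : ∀ r : ℝ, 0 ≤ r → ∀ x, maxAvg F s x ^ r = ENNReal.ofReal (g x ^ r) := by
    intro r hr x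
    rw [hg, ← ENNReal.ofReal_rpow_of_nonneg ENNReal.toReal_nonneg hr,
      ENNReal.ofReal_toReal (htop x)]
  have hgm : Measurable g := hM.ennreal_toReal
  have hset : ∀ t : ℝ, 0 < t → {x | t < g x} = {x | ENNReal.ofReal t < maxAvg F s x} := by
    intro t ht
    ext x
    exact (ENNReal.ofReal_lt_iff_lt_toReal ht.le (htop x)).symm
  have hq1 : ENNReal.ofReal (q - 1) ≠ 0 := by simp [hq]
  -- Layer-cake formula twice: exponent q for Lebesgue measure and q - 1 for the measure with
  -- density `F`. The weak type inequality compares the two integrands.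
  have hl1 := lintegral_rpow_eq_lintegral_meas_lt_mul volume
    (Filter.Eventually.of_forall fun x => ENNReal.toReal_nonneg) hgm.aemeasurable
    (p := q) (by linarith)
  have hl2 := lintegral_rpow_eq_lintegral_meas_lt_mul (volume.withDensity F)
    (Filter.Eventually.of_forall fun x => ENNReal.toReal_nonneg) hgm.aemeasurable
    (p := q - 1) (by linarith)
  have hl3 : ∫⁻ x, F x * maxAvg F s x ^ (q - 1) =
      ∫⁻ x, ENNReal.ofReal (g x ^ (q - 1)) ∂(volume.withDensity F) := by
    rw [lintegral_withDensity_eq_lintegral_mul₀ hF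
      (hgm.pow_const _).ennreal_ofReal.aemeasurable]
    exact lintegral_congr fun x => by rw [Pi.mul_apply, hpow _ (by linarith)]
  rw [lintegral_congr (hpow q (by linarith)), hl1, hl3, hl2]
  set J := ∫⁻ t in Ioi (0 : ℝ), volume.withDensity F {x | t < g x} *
    ENNReal.ofReal (t ^ (q - 1 - 1)) with hJ
  have hmain : ∫⁻ t in Ioi (0 : ℝ), volume {x | t < g x} * ENNReal.ofReal (t ^ (q - 1)) ≤
      3 * J := by
    rw [hJ, ← lintegral_const_mul' _ _ (by norm_num)]
    refine setLIntegral_mono' measurableSet_Ioi fun t ht => ?_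
    have ht : 0 < t := ht
    have hw := mul_volume_maxAvg_le hF s (ENNReal.ofReal t)
    rw [← hset t ht] at hw
    rw [withDensity_apply _ (measurableSet_lt measurable_const hgm)]
    have e : ENNReal.ofReal (t ^ (q - 1)) = ENNReal.ofReal t * ENNReal.ofReal (t ^ (q - 1 - 1)) := by
      rw [← ENNReal.ofReal_mul ht.le, ← Real.rpow_one_add' ht.le (by linarith)]
      congr 2; ring
    rw [e, ← mul_assoc, mul_comm (volume _), ← mul_assoc]
    gcongr
  calc _ ≤ ENNReal.ofReal q * (3 * J) := by gcongr
    _ = 3 * ENNReal.ofReal q / ENNReal.ofReal (q - 1) * (ENNReal.ofReal (q - 1) * J) := by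
        rw [← mul_assoc (_ / _), ENNReal.div_mul_cancel hq1 ENNReal.ofReal_ne_top]
        ring


/-! ### Garsia–Neveu summation by parts and the L^{2q} bound -/

lemma rpow_add_mul_rpow_le {q a b : ℝ} (hq : 1 < q) (ha : 0 ≤ a) (hb : 0 ≤ b) :
    b ^ q ≤ a ^ q + q * b ^ (q - 1) * (b - a) := by
  have hc := Real.HolderConjugate.conjExponent hq
  have h := Real.young_inequality_of_nonneg ha (Real.rpow_nonneg hb (q - 1)) hc
  have e : (q - 1) * q.conjExponent = q := by
    rw [Real.conjExponent]; field_simp [show q - 1 ≠ 0 by linarith]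
  have e' : b ^ q = b ^ (q - 1) * b := by
    rcases eq_or_lt_of_le hb with rfl | hb
    · rw [Real.zero_rpow (by linarith), mul_zero]
    · rw [← Real.rpow_add_one hb.ne', sub_add_cancel]
  rw [← Real.rpow_mul hb, e, Real.conjExponent] at h
  have h2 : q * (a * b ^ (q - 1)) ≤ a ^ q + (q - 1) * b ^ q := by
    calc q * (a * b ^ (q - 1)) ≤ q * (a ^ q / q + b ^ q / (q / (q - 1))) := by gcongr
      _ = _ := by field_simp
  nlinarith

/-- An upper Riemann sum for b^q = q ∫₀^b (b - s) d(s^{q-1}). The induction step is the tangent-line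
inequality for the convex power, and the free endpoint `c` is needed because the last partial sum
changes with `n`. -/
lemma rpow_le_mul_sum_sub_rpow {q : ℝ} (hq : 1 < q) {b : ℕ → ℝ} (h0 : b 0 = 0)
    (hb : Monotone b) (n : ℕ) {c : ℝ} (hc : b n ≤ c) :
    b n ^ q + q * b n ^ (q - 1) * (c - b n) ≤
      q * ∑ i ∈ Finset.range n, (b (i + 1) ^ (q - 1) - b i ^ (q - 1)) * (c - b i) := by
  induction n with
  | zero => simp [h0, Real.zero_rpow (show q ≠ 0 by linarith),
      Real.zero_rpow (show q - 1 ≠ 0 by linarith)]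
  | succ n ih =>
    have hn : 0 ≤ b n := h0 ▸ hb (Nat.zero_le n)
    have h1 := ih ((hb (Nat.le_succ n)).trans hc)
    have h2 := rpow_add_mul_rpow_le hq hn (hn.trans (hb (Nat.le_succ n)))
    rw [Finset.sum_range_succ]
    nlinarith

lemma sum_range_tsub_add {g : ℕ → ℝ≥0∞} (hg : Monotone g) (n : ℕ) :
    ∑ i ∈ Finset.range n, (g (i + 1) - g i) + g 0 = g n := by
  induction n with
  | zero => simp
  | succ n ih =>
    rw [Finset.sum_range_succ, add_right_comm, ih, add_tsub_cancel_of_le (hg (Nat.le_succ n))]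

/-- The Garsia–Neveu summation by parts: a power of a sum is dominated by the increments of a lower
power, paired with the tails. -/
lemma sum_rpow_le_mul_sum_tsub {q : ℝ} (hq : 1 < q) (u : ℕ → ℝ≥0∞) (n : ℕ)
    (hu : ∀ i, u i ≠ ∞) :
    (∑ i ∈ Finset.range n, u i) ^ q ≤ ENNReal.ofReal q * ∑ i ∈ Finset.range n,
      ((∑ j ∈ Finset.range (i + 1), u j) ^ (q - 1) - (∑ j ∈ Finset.range i, u j) ^ (q - 1)) *
        ∑ j ∈ Finset.Ico i n, u j := by
  lift u to ℕ → ℝ≥0 using hu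
  set b : ℕ → ℝ≥0 := fun i => ∑ j ∈ Finset.range i, u j with hb
  have hbm : Monotone b := fun i j hij =>
    Finset.sum_le_sum_of_subset (Finset.range_mono hij)
  have hr := rpow_le_mul_sum_sub_rpow hq (b := fun i => (b i : ℝ)) (by simp [hb])
    (fun i j h => NNReal.coe_le_coe.2 (hbm h)) n le_rfl
  have hq1 : 0 ≤ q - 1 := by linarith
  have key : b n ^ q ≤ q.toNNReal * ∑ i ∈ Finset.range n,
      (b (i + 1) ^ (q - 1) - b i ^ (q - 1)) * ∑ j ∈ Finset.Ico i n, u j := by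
    rw [← NNReal.coe_le_coe]
    push_cast [Real.coe_toNNReal q (by linarith)]
    rw [sub_self, mul_zero, add_zero] at hr
    refine hr.trans_eq ?_
    congr 1
    refine Finset.sum_congr rfl fun i hi => ?_
    rw [NNReal.coe_sub (NNReal.rpow_le_rpow (hbm (Nat.le_succ i)) hq1)]
    push_cast
    congr 1
    have hsum : b i + ∑ j ∈ Finset.Ico i n, u j = b n :=
      Finset.sum_range_add_sum_Ico _ (Finset.mem_range.1 hi).le
    rw [← hsum]
    push_cast
    ring
  have hcoe : ∀ i, ∑ j ∈ Finset.range i, (u j : ℝ≥0∞) = (b i : ℝ≥0∞) := fun i => by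
    simp [hb]
  simp only [hcoe, ← ENNReal.coe_rpow_of_nonneg _ hq1,
    ← ENNReal.coe_rpow_of_nonneg _ (show 0 ≤ q by linarith)]
  rw [ENNReal.ofReal]
  exact_mod_cast key

lemma le_cellAvg_of_scale_mul_le {F : ℝ → ℝ≥0∞} {k m : ℤ} {z C : ℝ≥0∞}
    (h : scale k * z ≤ C * ∫⁻ x in dyadicInterval k m, F x) : z ≤ C * cellAvg F k m := by
  rw [← scale_mul_cellAvg, mul_left_comm] at h
  exact (ENNReal.mul_le_mul_iff_right (scale_ne_zero k) (scale_ne_top k)).1 h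

/-- A crude bound at a single scale, which serves only to make the quantities in the L^{2q} argument
finite. -/
lemma cellOsc_sq_le_maxAvg {f : ℝ → 𝕜} (hf : ∀ a b, IntervalIntegrable f volume a b)
    {s : Finset ℤ} {k : ℤ} (hk : k ∈ s) (x : ℝ) :
    cellOsc f k ⌊x / (2 : ℝ) ^ k⌋ ^ 2 ≤ 60 * maxAvg (fun y => ‖f y‖ₑ ^ 2) s x := by
  set F : ℝ → ℝ≥0∞ := fun y => ‖f y‖ₑ ^ 2 with hF
  set m := ⌊x / (2 : ℝ) ^ k⌋ with hm
  have hc : ∀ m, ‖cellMean f k m‖ₑ ^ 2 ≤ cellAvg F k m := fun m => by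
    have := le_cellAvg_of_scale_mul_le (C := 1)
      ((scale_mul_cellMean_sq_le hf k m).trans_eq (one_mul _).symm)
    rwa [one_mul] at this
  have hj : ∀ m, jump f k m ^ 2 ≤ 2 * cellAvg F k (m + 1) + 2 * cellAvg F k m := fun m =>
    (pow_le_pow_left' enorm_sub_le 2).trans ((add_sq_le _ _).trans (by gcongr <;> exact hc _))
  have ho : ∀ m, fineOsc f k m ^ 2 ≤ 4 * cellAvg F k m := fun m =>
    le_cellAvg_of_scale_mul_le (scale_mul_fineOsc_sq_le hf k m)
  have h1 : cellAvg F k (m + (-1)) ≤ maxAvg F s x := le_maxAvg hk (by simp) x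
  have h2 : cellAvg F k m ≤ maxAvg F s x := by
    simpa using le_maxAvg (F := F) hk (c := 0) (by simp) x
  have h3 : cellAvg F k (m + 1) ≤ maxAvg F s x := le_maxAvg hk (by simp) x
  have hj1 := hj (m + (-1))
  rw [neg_add_cancel_right] at hj1
  set M := maxAvg F s x
  calc cellOsc f k m ^ 2 ≤ _ := cellOsc_sq_le hf k m
    _ ≤ 3 * ((2 * M + 2 * M + (2 * M + 2 * M)) + (4 * M + 4 * M + 4 * M)) := by
        gcongr 3 * (?_ + ?_ + (?_ + ?_ + ?_))
        · exact hj1.trans (by gcongr)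
        · exact (hj m).trans (by gcongr)
        · exact (ho _).trans (by gcongr)
        · exact (ho _).trans (by gcongr)
        · exact (ho _).trans (by gcongr)
    _ = _ := by ring

lemma setLIntegral_three_le (F : ℝ → ℝ≥0∞) (k m : ℤ) :
    ∫⁻ y in Ico ((m - 1) * (2 : ℝ) ^ k) ((m + 2) * (2 : ℝ) ^ k), F y ≤
      scale k * (cellAvg F k (m + (-1)) + cellAvg F k m + cellAvg F k (m + 1)) := by
  simp only [mul_add, scale_mul_cellAvg]
  have hsub : Ico ((m - 1) * (2 : ℝ) ^ k) ((m + 2) * (2 : ℝ) ^ k) ⊆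
      dyadicInterval k (m + (-1)) ∪ dyadicInterval k m ∪ dyadicInterval k (m + 1) := by
    intro y hy
    simp only [dyadicInterval, mem_union, mem_Ico] at hy ⊢
    push_cast
    rcases lt_or_ge y (m * 2 ^ k) with h | h
    · exact Or.inl (Or.inl ⟨by linarith [hy.1], by linarith⟩)
    · rcases lt_or_ge y ((m + 1) * 2 ^ k) with h' | h'
      · exact Or.inl (Or.inr ⟨h, h'⟩)
      · exact Or.inr ⟨h', by linarith [hy.2]⟩
  refine (lintegral_mono_set hsub).trans ((lintegral_union_le _ _ _).trans ?_)
  gcongr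
  exact lintegral_union_le _ _ _

/-- The `L^{2q}` bound for the square function built from the cell oscillations. -/
lemma lintegral_sum_cellOsc_sq_rpow_le {f : ℝ → 𝕜}
    (hf : ∀ a b, IntervalIntegrable f volume a b) (hfm : AEMeasurable (fun y => ‖f y‖ₑ ^ 2))
    {q : ℝ} (hq : 1 < q) (hfin : ∫⁻ y, (‖f y‖ₑ ^ 2) ^ q ≠ ∞) (N : ℤ) (n : ℕ) :
    ∫⁻ x : ℝ, (∑ i ∈ Finset.range n, cellOsc f (N - i) ⌊x / (2 : ℝ) ^ (N - i)⌋ ^ 2) ^ q ≤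
      (ENNReal.ofReal q * 1332) ^ q * ((3 * ENNReal.ofReal q / ENNReal.ofReal (q - 1)) ^ q *
        ∫⁻ y, (‖f y‖ₑ ^ 2) ^ q) := by
  have hq1 : 0 ≤ q - 1 := by linarith
  set F : ℝ → ℝ≥0∞ := fun y => ‖f y‖ₑ ^ 2 with hF
  -- Scales run from coarse to fine as `i` grows, so partial sums depend on coarse cells and tails
  -- on finer ones.
  set s : Finset ℤ := (Finset.range n).image fun i : ℕ => N - i with hs
  have hsi : ∀ i ∈ Finset.range n, N - (i : ℤ) ∈ s := fun i hi => Finset.mem_image_of_mem _ hi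
  set M := maxAvg F s with hM
  have hMm : Measurable M := measurable_maxAvg F s
  set u : ℕ → ℝ → ℝ≥0∞ := fun i x => cellOsc f (N - i) ⌊x / (2 : ℝ) ^ (N - i)⌋ ^ 2 with hu
  have hum : ∀ i, Measurable (u i) := fun i =>
    measurable_comp_floor (N - i) (fun m => cellOsc f (N - i) m ^ 2)
  set b : ℕ → ℝ → ℝ≥0∞ := fun i x => ∑ j ∈ Finset.range i, u j x with hb
  have hbm : ∀ i, Measurable (b i) := fun i => Finset.measurable_fun_sum _ fun j _ => hum j
  have hutop : ∀ i x, u i x ≠ ∞ := fun i x =>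
    ((cellOsc_sq_le_maxAvg hf (Finset.mem_singleton_self (N - (i : ℤ))) x).trans_lt
      (ENNReal.mul_lt_top (by norm_num) (maxAvg_ne_top hfm hq hfin _ x).lt_top)).ne
  refine le_trans ?_ (mul_le_mul_right (lintegral_maxAvg_rpow_le hfm hq hfin s) _)
  change ∫⁻ x, b n x ^ q ≤ _
  refine lintegral_rpow_le_of_le_mul hq hMm.aemeasurable (hbm n).aemeasurable ?_ ?_
  · refine ((lintegral_mono (g := fun x => (n * 60 : ℝ≥0∞) ^ q * M x ^ q) fun x => ?_).trans_lt
      ?_).ne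
    · dsimp only
      rw [← ENNReal.mul_rpow_of_nonneg _ _ (by linarith)]
      refine ENNReal.rpow_le_rpow ?_ (by linarith)
      refine (Finset.sum_le_card_nsmul _ _ (60 * M x) fun i hi =>
        cellOsc_sq_le_maxAvg hf (hsi i hi) x).trans_eq ?_
      rw [Finset.card_range, nsmul_eq_mul, mul_assoc]
    · rw [lintegral_const_mul _ (hMm.pow_const q)]
      refine ENNReal.mul_lt_top (ENNReal.rpow_lt_top_of_nonneg (by linarith) ?_)
        (lintegral_maxAvg_rpow_ne_top hfm hq hfin s).lt_top
      exact ENNReal.mul_ne_top (ENNReal.natCast_ne_top n) (by norm_num)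
  · set w : ℕ → ℝ → ℝ≥0∞ := fun i x => b (i + 1) x ^ (q - 1) - b i x ^ (q - 1) with hw
    have hwm : ∀ i, Measurable (w i) := fun i =>
      ((hbm (i + 1)).pow_const _).sub ((hbm i).pow_const _)
    set T : ℕ → ℝ → ℝ≥0∞ := fun i x => ∑ j ∈ Finset.Ico i n, u j x with hT
    have hTm : ∀ i, Measurable (T i) := fun i => Finset.measurable_fun_sum _ fun j _ => hum j
    have hstep : ∀ i ∈ Finset.range n, ∫⁻ x, w i x * T i x ≤ 1332 * ∫⁻ x, w i x * M x := by
      intro i hi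
      rw [lintegral_eq_tsum_dyadic (N - i), lintegral_eq_tsum_dyadic (N - i),
        ← ENNReal.tsum_mul_left]
      refine ENNReal.tsum_le_tsum fun m => ?_
      set x₀ : ℝ := m * (2 : ℝ) ^ (N - (i : ℤ)) with hx₀
      -- `b (i + 1)` uses only scale `N - i` and coarser ones, so it is constant on cells of scale
      -- `N - i`. This needs `cellOsc`, which depends on the cell and not on the point.
      have hbc : ∀ j ≤ i + 1, ∀ x ∈ dyadicInterval (N - i) m, b j x = b j x₀ := by
        intro j hj x hx
        refine Finset.sum_congr rfl fun j' hj' => ?_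
        have hj' := Finset.mem_range.1 hj'
        simp only [hu]
        rw [floor_eq_floor_of_le (k := N - i) (j := N - j') (x := x) (y := x₀) (by omega)]
        rw [hx₀, mul_div_cancel_right₀ _ (two_zpow_pos _).ne', Int.floor_intCast,
          mem_dyadicInterval_iff.1 hx]
      have hwc : ∀ x ∈ dyadicInterval (N - i) m, w i x = w i x₀ := by
        intro x hx
        simp only [hw]
        rw [hbc (i + 1) le_rfl x hx, hbc i (Nat.le_succ i) x hx]
      have hwg : ∀ g : ℝ → ℝ≥0∞, ∫⁻ x in dyadicInterval (N - i) m, w i x * g x =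
          ∫⁻ x in dyadicInterval (N - i) m, w i x₀ * g x := fun g =>
        setLIntegral_congr_fun (measurableSet_dyadicInterval _ m)
          fun x hx => congrArg (· * g x) (hwc x hx)
      rw [hwg, hwg, lintegral_const_mul _ (hTm i), lintegral_const_mul _ hMm, mul_left_comm]
      refine mul_le_mul_right ?_ _
      have hloc := setLIntegral_sum_cellOsc_sq_le hf (N - i) m
        (s := (Finset.Ico i n).image fun j : ℕ => N - (j : ℤ)) (by
          intro k hk
          obtain ⟨j, hj, rfl⟩ := Finset.mem_image.1 hk
          have := (Finset.mem_Ico.1 hj).1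
          omega)
      have e : ∀ x : ℝ, ∑ k ∈ (Finset.Ico i n).image (fun j : ℕ => N - (j : ℤ)),
          cellOsc f k ⌊x / (2 : ℝ) ^ k⌋ ^ 2 = T i x := fun x => by
        rw [Finset.sum_image (by intro j _ j' _ h; simpa using h)]
      rw [lintegral_congr e] at hloc
      refine hloc.trans ((mul_le_mul_right (setLIntegral_three_le F _ m) _).trans ?_)
      -- The means over the cell and its two neighbours are at most `M` at every point of the cell,
      -- so the threefold interval costs a factor 3 and 1332 = 3·444.
      have hmax : ∀ c ∈ ({-1, 0, 1} : Finset ℤ), ∀ x ∈ dyadicInterval (N - i) m,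
          cellAvg F (N - i) (m + c) ≤ M x := by
        intro c hc x hx
        rw [← mem_dyadicInterval_iff.1 hx]
        exact le_maxAvg (hsi i hi) hc x
      have hint : ∀ c ∈ ({-1, 0, 1} : Finset ℤ), scale (N - i) * cellAvg F (N - i) (m + c) ≤
          ∫⁻ x in dyadicInterval (N - i) m, M x := by
        intro c hc
        rw [mul_comm, ← volume_dyadicInterval _ m, ← setLIntegral_const]
        exact setLIntegral_mono' (measurableSet_dyadicInterval _ m) (hmax c hc)
      have h1 := hint (-1) (by simp)
      have h2 := hint 0 (by simp)
      have h3 := hint 1 (by simp)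
      rw [add_zero] at h2
      calc _ = 444 * (scale (N - i) * cellAvg F (N - i) (m + -1) +
            scale (N - i) * cellAvg F (N - i) m + scale (N - i) * cellAvg F (N - i) (m + 1)) := by
            ring
        _ ≤ 444 * ((∫⁻ x in dyadicInterval (N - i) m, M x) +
            (∫⁻ x in dyadicInterval (N - i) m, M x) +
            ∫⁻ x in dyadicInterval (N - i) m, M x) := by gcongr
        _ = _ := by ring
    have hwT : ∀ i ∈ Finset.range n, Measurable fun x => w i x * T i x :=
      fun i _ => (hwm i).mul (hTm i)
    have hwM : ∀ i ∈ Finset.range n, Measurable fun x => w i x * M x :=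
      fun i _ => (hwm i).mul hMm
    calc ∫⁻ x, b n x ^ q
        ≤ ∫⁻ x, ENNReal.ofReal q * ∑ i ∈ Finset.range n, w i x * T i x :=
          lintegral_mono fun x => sum_rpow_le_mul_sum_tsub hq (fun i => u i x) n
            (fun i => hutop i x)
      _ = ENNReal.ofReal q * ∑ i ∈ Finset.range n, ∫⁻ x, w i x * T i x := by
          rw [lintegral_const_mul' _ _ ENNReal.ofReal_ne_top,
            lintegral_finsetSum _ hwT]
      _ ≤ ENNReal.ofReal q * ∑ i ∈ Finset.range n, 1332 * ∫⁻ x, w i x * M x := by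
          gcongr with i hi; exact hstep i hi
      _ = ENNReal.ofReal q * 1332 * ∫⁻ x, ∑ i ∈ Finset.range n, w i x * M x := by
          rw [← Finset.mul_sum, lintegral_finsetSum _ hwM, mul_assoc]
      _ = _ := by
          congr 1
          refine lintegral_congr fun x => ?_
          -- The increments telescope to `b n x ^ (q - 1)`, the form that the Hölder division takes.
          have hmono : Monotone fun i => b i x ^ (q - 1) := fun i j hij =>
            ENNReal.rpow_le_rpow (Finset.sum_le_sum_of_subset (Finset.range_mono hij)) hq1
          rw [← Finset.sum_mul, mul_comm]
          congr 1
          simp only [hw]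
          rw [← sum_range_tsub_add hmono n]
          simp [hb, ENNReal.zero_rpow_of_pos (show 0 < q - 1 by linarith)]


/-! ### From families of intervals to a real parameter; measurability -/

lemma IsIntervalAt.exists_ae_eq {k : ℤ} {x : ℝ} {J : Set ℝ} (h : IsIntervalAt k x J) :
    ∃ s ∈ Icc (x - (2 : ℝ) ^ k) x, J =ᵐ[volume] Ioc s (s + (2 : ℝ) ^ k) := by
  obtain ⟨hc, hx, hv⟩ := h
  have hdist : ∀ y ∈ J, |y - x| ≤ 2 ^ k := by
    intro y hy
    have h1 := measure_mono (μ := volume) (hc.uIcc_subset hx hy)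
    rw [uIcc, Real.volume_Icc, hv, max_sub_min_eq_abs] at h1
    exact (ENNReal.ofReal_le_ofReal_iff (by positivity)).1 h1
  have hbb : BddBelow J := ⟨x - 2 ^ k, fun y hy => by linarith [(abs_le.1 (hdist y hy)).1]⟩
  have hba : BddAbove J := ⟨x + 2 ^ k, fun y hy => by linarith [(abs_le.1 (hdist y hy)).2]⟩
  have hsub : J ⊆ Icc (sInf J) (sSup J) := fun y hy => ⟨csInf_le hbb hy, le_csSup hba hy⟩
  have hsup : Ioo (sInf J) (sSup J) ⊆ J := by
    intro y hy
    obtain ⟨a, ha, hay⟩ := exists_lt_of_csInf_lt ⟨x, hx⟩ hy.1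
    obtain ⟨b, hb, hyb⟩ := exists_lt_of_lt_csSup ⟨x, hx⟩ hy.2
    exact hc.out ha hb ⟨hay.le, hyb.le⟩
  have hae : J =ᵐ[volume] Ioc (sInf J) (sSup J) :=
    (hsub.eventuallyLE.trans Ioc_ae_eq_Icc.symm.le).antisymm
      (Ioo_ae_eq_Ioc.symm.le.trans hsup.eventuallyLE)
  have hlen : sSup J = sInf J + 2 ^ k := by
    have h1 := measure_congr hae
    rw [hv, Real.volume_Ioc, ENNReal.ofReal_eq_ofReal_iff (by positivity)
      (by linarith [csInf_le hbb hx, le_csSup hba hx])] at h1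
    linarith
  refine ⟨sInf J, ⟨?_, csInf_le hbb hx⟩, hlen ▸ hae⟩
  linarith [le_csSup hba hx]

lemma isIntervalAt_Icc {k : ℤ} {x s : ℝ} (hs : s ∈ Icc (x - (2 : ℝ) ^ k) x) :
    IsIntervalAt k x (Icc s (s + (2 : ℝ) ^ k)) :=
  ⟨ordConnected_Icc, ⟨hs.2, by linarith [hs.1]⟩, by rw [Real.volume_Icc, add_sub_cancel_left]⟩

lemma isIntervalAt_translateSet {k : ℤ} {x y : ℝ} {I : Set ℝ} (h : IsIntervalAt k y I) :
    IsIntervalAt k (y + x) (translateSet I x) := by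
  obtain ⟨hc, h0, hv⟩ := h
  refine ⟨?_, ⟨y, h0, rfl⟩, ?_⟩
  · rw [translateSet, image_add_right]
    exact hc.preimage_mono fun a b hab => by simpa using hab
  · rw [translateSet, image_add_right, measure_preimage_add_right, hv]

lemma image_translateSet_originIntervals (k : ℤ) (x : ℝ) :
    (fun I => translateSet I x) '' originIntervals k = {J | IsIntervalAt k x J} := by
  ext J
  constructor
  · rintro ⟨I, hI, rfl⟩
    have := isIntervalAt_translateSet (x := x) hI
    rwa [zero_add] at this
  · intro hJ
    refine ⟨translateSet J (-x), ?_, ?_⟩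
    · have := isIntervalAt_translateSet (x := -x) hJ
      rwa [add_neg_cancel] at this
    · simp [translateSet, ← preimage_comp, Function.comp_def]

lemma intervalMean_eq {k : ℤ} {s : ℝ} {J : Set ℝ} (f : ℝ → 𝕜)
    (hJ : J =ᵐ[volume] Ioc s (s + (2 : ℝ) ^ k)) :
    intervalMean J f = ((2 : ℝ) ^ k)⁻¹ • ∫ y in s..(s + (2 : ℝ) ^ k), f y := by
  have hk := two_zpow_pos k
  rw [intervalMean, setAverage_eq, measureReal_congr hJ, setIntegral_congr_set hJ,
    intervalIntegral.integral_of_le (by linarith), Real.volume_real_Ioc_of_le (by linarith),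
    add_sub_cancel_left]

lemma dyadicExpectation_eq (k : ℤ) (f : ℝ → 𝕜) (x : ℝ) :
    dyadicExpectation k f x = cellMean f k ⌊x / (2 : ℝ) ^ k⌋ := by
  rw [dyadicExpectation, cellMean, dyadicInterval, add_one_mul]
  exact intervalMean_eq f Ico_ae_eq_Ioc

/-- The deviation, from the dyadic expectation at `x`, of the means over intervals of length `2 ^ k`
containing `x`. -/
noncomputable def scaleOsc (f : ℝ → 𝕜) (k : ℤ) (x : ℝ) : ℝ≥0∞ :=
  ⨆ r ∈ Icc (-(2 : ℝ) ^ k) 0, ‖((2 : ℝ) ^ k)⁻¹ • (∫ y in (x + r)..(x + r + (2 : ℝ) ^ k), f y) -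
    cellMean f k ⌊x / (2 : ℝ) ^ k⌋‖ₑ

lemma enorm_intervalMean_sub_le {k : ℤ} {x : ℝ} {J : Set ℝ} (hJ : IsIntervalAt k x J)
    (f : ℝ → 𝕜) : ‖intervalMean J f - dyadicExpectation k f x‖ₑ ≤ scaleOsc f k x := by
  obtain ⟨s, hs, hae⟩ := IsIntervalAt.exists_ae_eq hJ
  rw [intervalMean_eq f hae, dyadicExpectation_eq]
  refine le_iSup₂_of_le (s - x) ⟨by linarith [hs.1], by linarith [hs.2]⟩ ?_
  rw [add_sub_cancel]

/-- Endpoints are null, so only the position of the interval matters. The position relative to `x`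
ranges over a set independent of `x`, which the measurability proof exploits. -/
lemma iSup_originIntervals_eq (f : ℝ → 𝕜) (k : ℤ) (x : ℝ) :
    ⨆ I ∈ originIntervals k, ‖intervalMean (translateSet I x) f - dyadicExpectation k f x‖ₑ ^ 2 =
      scaleOsc f k x ^ 2 := by
  have h : ⨆ I ∈ originIntervals k,
      ‖intervalMean (translateSet I x) f - dyadicExpectation k f x‖ₑ ^ 2 =
      ⨆ J ∈ {J | IsIntervalAt k x J}, ‖intervalMean J f - dyadicExpectation k f x‖ₑ ^ 2 := by
    rw [← image_translateSet_originIntervals, iSup_image]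
  rw [h]
  refine le_antisymm (iSup₂_le fun J hJ =>
    pow_le_pow_left' (enorm_intervalMean_sub_le hJ f) 2) ?_
  simp only [scaleOsc, ENNReal.iSup_pow_of_ne_zero two_ne_zero]
  refine iSup₂_le fun r hr => ?_
  refine le_iSup₂_of_le (Icc (x + r) (x + r + (2 : ℝ) ^ k))
    (isIntervalAt_Icc ⟨by linarith [hr.1], by linarith [hr.2]⟩) ?_
  rw [intervalMean_eq f Ioc_ae_eq_Icc.symm, dyadicExpectation_eq]

lemma maximalSquareFunction_eq (f : ℝ → 𝕜) (x : ℝ) :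
    maximalSquareFunction f x = (∑' k : ℤ, scaleOsc f k x ^ 2) ^ (1 / 2 : ℝ) := by
  simp only [maximalSquareFunction, iSup_originIntervals_eq]

lemma familySquareFunction_le {I : ℤ → ℝ → Set ℝ} (hI : IsIntervalFamily I) (f : ℝ → 𝕜)
    (x : ℝ) : familySquareFunction I f x ≤ maximalSquareFunction f x := by
  rw [maximalSquareFunction_eq, familySquareFunction]
  refine ENNReal.rpow_le_rpow (ENNReal.tsum_le_tsum fun k => ?_) (by norm_num)
  exact pow_le_pow_left' (enorm_intervalMean_sub_le (hI k x) f) 2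

lemma scaleOsc_le_cellOsc (f : ℝ → 𝕜) (k : ℤ) (x : ℝ) :
    scaleOsc f k x ≤ cellOsc f k ⌊x / (2 : ℝ) ^ k⌋ := by
  refine iSup₂_le fun r hr => ?_
  have hx := mem_dyadicInterval_floor k x
  exact le_iSup₂_of_le (x + r) ⟨by linarith [hx.1, hr.1], by linarith [hx.2, hr.2]⟩ le_rfl

/-- Primitives are continuous, so every fixed shift gives a continuous function of `x`, and even an
uncountable supremum of these is lower semicontinuous. The constant `c` is the mean over one cell;
`measurable_comp_floor_prod` glues the cells. -/
lemma measurable_iSup_enorm_mean_sub {f : ℝ → 𝕜} (hf : ∀ a b, IntervalIntegrable f volume a b)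
    (h : ℝ) (c : 𝕜) (s : Set ℝ) :
    Measurable fun x : ℝ => ⨆ r ∈ s, ‖h⁻¹ • (∫ y in (x + r)..(x + r + h), f y) - c‖ₑ := by
  have hcont : Continuous fun b => ∫ y in (0 : ℝ)..b, f y :=
    intervalIntegral.continuous_primitive hf 0
  refine LowerSemicontinuous.measurable (lowerSemicontinuous_biSup fun r _ =>
    Continuous.lowerSemicontinuous ?_)
  have e : ∀ x, ∫ y in (x + r)..(x + r + h), f y =
      (∫ y in (0 : ℝ)..(x + r + h), f y) - ∫ y in (0 : ℝ)..(x + r), f y := fun x =>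
    (intervalIntegral.integral_interval_sub_left (hf _ _) (hf _ _)).symm
  simp only [e]
  have h1 : Continuous fun x : ℝ => ∫ y in (0 : ℝ)..(x + r + h), f y :=
    hcont.comp ((continuous_id.add continuous_const).add continuous_const)
  have h2 : Continuous fun x : ℝ => ∫ y in (0 : ℝ)..(x + r), f y :=
    hcont.comp (continuous_id.add continuous_const)
  exact (((h1.sub h2).const_smul _).sub continuous_const).enorm

lemma measurable_comp_floor_prod {G : ℤ → ℝ → ℝ≥0∞} (hG : ∀ m, Measurable (G m)) (k : ℤ) :
    Measurable fun x : ℝ => G ⌊x / (2 : ℝ) ^ k⌋ x := by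
  have h2 : Measurable fun p : ℤ × ℝ => G p.1 p.2 := measurable_from_prod_countable_right hG
  have h3 : Measurable fun x : ℝ => ((⌊x / (2 : ℝ) ^ k⌋, x) : ℤ × ℝ) :=
    (Int.measurable_floor.comp (measurable_id.div_const _)).prodMk measurable_id
  exact h2.comp h3

lemma measurable_scaleOsc {f : ℝ → 𝕜} (hf : ∀ a b, IntervalIntegrable f volume a b) (k : ℤ) :
    Measurable (scaleOsc f k) :=
  measurable_comp_floor_prod
    (fun m => measurable_iSup_enorm_mean_sub hf ((2 : ℝ) ^ k) (cellMean f k m) _) k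

lemma measurable_maximalSquareFunction {f : ℝ → 𝕜}
    (hf : ∀ a b, IntervalIntegrable f volume a b) : Measurable (maximalSquareFunction f) := by
  simp only [funext (maximalSquareFunction_eq f)]
  exact (Measurable.tsum fun k => (measurable_scaleOsc hf k).pow_const 2).pow_const _

/-! ### All scales at once: the Lᵖ bound -/

lemma tsum_int_eq_iSup (g : ℤ → ℝ≥0∞) :
    ∑' k, g k = ⨆ N : ℕ, ∑ i ∈ Finset.range (2 * N + 1), g ((N : ℤ) - i) := by
  rw [ENNReal.tsum_eq_iSup_sum' (fun N : ℕ => Finset.Icc (-(N : ℤ)) N)]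
  · refine iSup_congr fun N => Finset.sum_nbij' (fun k => ((N : ℤ) - k).toNat)
      (fun i => (N : ℤ) - i) ?_ ?_ ?_ ?_ ?_
    all_goals
      intro a ha
      simp only [Finset.mem_Icc, Finset.mem_range] at ha ⊢
    · omega
    · omega
    · omega
    · omega
    · congr 1; omega
  · intro t
    refine ⟨t.sup Int.natAbs, fun k hk => ?_⟩
    have := Finset.le_sup (f := Int.natAbs) hk
    rw [Finset.mem_Icc]
    omega

lemma monotone_sum_sub (g : ℤ → ℝ≥0∞) :
    Monotone fun N : ℕ => ∑ i ∈ Finset.range (2 * N + 1), g ((N : ℤ) - i) := by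
  refine monotone_nat_of_le_succ fun N => ?_
  rw [show 2 * (N + 1) + 1 = (2 * N + 1 + 1) + 1 by ring, Finset.sum_range_succ _ (2 * N + 1 + 1),
    Finset.sum_range_succ' _ (2 * N + 1)]
  refine le_add_right (le_add_right (le_of_eq (Finset.sum_congr rfl fun i _ => ?_)))
  congr 1; push_cast; ring

lemma lintegral_tsum_cellOsc_sq_rpow_le {f : ℝ → 𝕜}
    (hf : ∀ a b, IntervalIntegrable f volume a b) (hfm : AEMeasurable (fun y => ‖f y‖ₑ ^ 2))
    {q : ℝ} (hq : 1 < q) (hfin : ∫⁻ y, (‖f y‖ₑ ^ 2) ^ q ≠ ∞) :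
    ∫⁻ x : ℝ, (∑' k : ℤ, cellOsc f k ⌊x / (2 : ℝ) ^ k⌋ ^ 2) ^ q ≤
      (ENNReal.ofReal q * 1332) ^ q * ((3 * ENNReal.ofReal q / ENNReal.ofReal (q - 1)) ^ q *
        ∫⁻ y, (‖f y‖ₑ ^ 2) ^ q) := by
  have hq0 : 0 < q := by linarith
  have e : ∀ x : ℝ, (∑' k : ℤ, cellOsc f k ⌊x / (2 : ℝ) ^ k⌋ ^ 2) ^ q = ⨆ N : ℕ,
      (∑ i ∈ Finset.range (2 * N + 1),
        cellOsc f ((N : ℤ) - i) ⌊x / (2 : ℝ) ^ ((N : ℤ) - i)⌋ ^ 2) ^ q := fun x => by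
    rw [tsum_int_eq_iSup]
    exact (ENNReal.orderIsoRpow q hq0).map_iSup _
  -- Monotone convergence along the windows of scales from -N to N; the finite bound does not depend
  -- on the window.
  rw [lintegral_congr e, lintegral_iSup]
  · exact iSup_le fun N => lintegral_sum_cellOsc_sq_rpow_le hf hfm hq hfin N _
  · exact fun N => (Finset.measurable_fun_sum _ fun i _ =>
      measurable_comp_floor ((N : ℤ) - (i : ℕ)) (fun m => cellOsc f ((N : ℤ) - (i : ℕ)) m ^ 2)).pow_const q
  · exact fun N N' h x => ENNReal.rpow_le_rpow
      (monotone_sum_sub (fun k => cellOsc f k ⌊x / (2 : ℝ) ^ k⌋ ^ 2) h) hq0.le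

lemma intervalIntegrable_of_memLp {f : ℝ → 𝕜} {p : ℝ≥0∞} (hp : 1 ≤ p) (hf : MemLp f p volume)
    (a b : ℝ) : IntervalIntegrable f volume a b := by
  rw [intervalIntegrable_iff']
  exact (hf.locallyIntegrable hp).integrableOn_isCompact isCompact_uIcc

/-- The `Lᵖ` bound for the maximal square function, `2 < p < ∞`. -/
lemma exists_eLpNorm_maximalSquareFunction_le (𝕜 : Type*) [RCLike 𝕜] {p : ℝ≥0∞} (hp2 : 2 < p)
    (hp : p < ∞) :
    ∃ C : ℝ≥0, ∀ f : ℝ → 𝕜, MemLp f p volume →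
      eLpNorm (maximalSquareFunction f) p volume ≤ C * eLpNorm f p volume := by
  have hp0 : p ≠ 0 := (bot_lt_of_lt hp2).ne'
  set r := p.toReal with hr
  have hr2 : 2 < r := by
    have := (ENNReal.toReal_lt_toReal (by norm_num) hp.ne).2 hp2
    simpa using this
  -- The Lᵖ norm of the square function is governed by the L^{p/2} norm of its square, and p > 2 is
  -- what makes q > 1.
  set q := r / 2 with hqdef
  have hq : 1 < q := by rw [hqdef]; linarith
  have hq1 : ENNReal.ofReal (q - 1) ≠ 0 := by simp [hq]
  set K : ℝ≥0∞ := (ENNReal.ofReal q * 1332) ^ q *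
    (3 * ENNReal.ofReal q / ENNReal.ofReal (q - 1)) ^ q with hK
  have hKtop : K ≠ ∞ := by
    refine ENNReal.mul_ne_top (ENNReal.rpow_ne_top_of_nonneg (by linarith) ?_)
      (ENNReal.rpow_ne_top_of_nonneg (by linarith) ?_)
    · exact ENNReal.mul_ne_top ENNReal.ofReal_ne_top (by norm_num)
    · exact ENNReal.div_ne_top (ENNReal.mul_ne_top (by norm_num) ENNReal.ofReal_ne_top) hq1
  have hKr : K ^ (1 / r) ≠ ∞ := ENNReal.rpow_ne_top_of_nonneg (by positivity) hKtop
  refine ⟨(K ^ (1 / r)).toNNReal, fun f hf => ?_⟩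
  have hfi := intervalIntegrable_of_memLp (by exact le_trans (by norm_num) hp2.le) hf
  have hsq : ∀ z : ℝ≥0∞, (z ^ 2) ^ q = z ^ r := fun z => by
    rw [← ENNReal.rpow_natCast, ← ENNReal.rpow_mul, hqdef]
    congr 1; push_cast; ring
  have hfin : ∫⁻ y, (‖f y‖ₑ ^ 2) ^ q ≠ ∞ := by
    simp only [hsq]
    exact (lintegral_rpow_enorm_lt_top_of_eLpNorm_lt_top hp0 hp.ne hf.2).ne
  rw [ENNReal.coe_toNNReal hKr, eLpNorm_eq_lintegral_rpow_enorm_toReal hp0 hp.ne,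
    eLpNorm_eq_lintegral_rpow_enorm_toReal hp0 hp.ne, ← hr,
    ← ENNReal.mul_rpow_of_nonneg _ _ (by positivity)]
  refine ENNReal.rpow_le_rpow ?_ (by positivity)
  have hmain := lintegral_tsum_cellOsc_sq_rpow_le hfi (hf.1.enorm.pow_const 2) hq hfin
  rw [← mul_assoc, ← hK] at hmain
  simp only [hsq] at hmain
  refine le_trans (lintegral_mono fun x => ?_) hmain
  rw [enorm_eq_self, maximalSquareFunction_eq, ← ENNReal.rpow_mul,
    show 1 / 2 * r = q by rw [hqdef]; ring]
  exact ENNReal.rpow_le_rpow (ENNReal.tsum_le_tsum fun k =>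
    pow_le_pow_left' (scaleOsc_le_cellOsc f k x) 2) (by linarith)


/-! ### The dyadic BMO bound -/

lemma sqrt_tsum_add_sq_le {ι : Type*} [Countable ι] (a b : ι → ℝ≥0∞) :
    (∑' i, (a i + b i) ^ 2) ^ (1 / 2 : ℝ) ≤
      (∑' i, a i ^ 2) ^ (1 / 2 : ℝ) + (∑' i, b i ^ 2) ^ (1 / 2 : ℝ) := by
  let _ : MeasurableSpace ι := ⊤
  have h := ENNReal.lintegral_Lp_add_le (μ := Measure.count) (p := 2)
    (measurable_of_countable a).aemeasurable (measurable_of_countable b).aemeasurable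
    (by norm_num)
  simp only [lintegral_count, Pi.add_apply] at h
  exact_mod_cast h

lemma tsum_int_split (g : ℤ → ℝ≥0∞) (K : ℤ) :
    ∑' k, g k = ∑' i : ℕ, g (K - i) + ∑' i : ℕ, g (K + 1 + i) := by
  rw [← tsum_int_shift g (K + 1), add_comm (∑' i : ℕ, g (K - i))]
  have h := HasSum.of_nat_of_neg_add_one (f := fun k : ℤ => g (k + (K + 1)))
    (ENNReal.summable (f := fun i : ℕ => g ((i : ℤ) + (K + 1)))).hasSum
    (ENNReal.summable (f := fun i : ℕ => g (-((i : ℤ) + 1) + (K + 1)))).hasSum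
  rw [h.tsum_eq]
  congr 1 <;> refine tsum_congr fun i => congrArg g ?_ <;> ring

lemma enorm_toReal_sub_toReal_le {a b e : ℝ≥0∞} (ha : a ≠ ∞) (hb : b ≠ ∞) (h1 : a ≤ b + e)
    (h2 : b ≤ a + e) : ‖a.toReal - b.toReal‖ₑ ≤ e := by
  induction e with
  | top => exact le_top
  | coe e =>
    lift a to ℝ≥0 using ha
    lift b to ℝ≥0 using hb
    norm_cast at h1 h2
    rw [← NNReal.coe_le_coe] at h1 h2
    push_cast at h1 h2
    rw [← ofReal_norm, ENNReal.ofReal_le_iff_le_toReal ENNReal.coe_ne_top, Real.norm_eq_abs,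
      abs_le]
    simp only [ENNReal.coe_toReal]
    constructor <;> linarith

/-- The part of the maximal square function with scales at most `K`. -/
noncomputable def fineSquare (f : ℝ → 𝕜) (K : ℤ) (x : ℝ) : ℝ≥0∞ :=
  (∑' i : ℕ, scaleOsc f (K - i) x ^ 2) ^ (1 / 2 : ℝ)

/-- The part of the maximal square function with scales above `K`. -/
noncomputable def coarseSquare (f : ℝ → 𝕜) (K : ℤ) (x : ℝ) : ℝ≥0∞ :=
  (∑' i : ℕ, scaleOsc f (K + 1 + i) x ^ 2) ^ (1 / 2 : ℝ)

lemma maximalSquareFunction_le_add (f : ℝ → 𝕜) (K : ℤ) (x : ℝ) :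
    maximalSquareFunction f x ≤ fineSquare f K x + coarseSquare f K x := by
  rw [maximalSquareFunction_eq, tsum_int_split _ K]
  exact ENNReal.rpow_add_le_add_rpow _ _ (by norm_num) (by norm_num)

lemma coarseSquare_le (f : ℝ → 𝕜) (K : ℤ) (x : ℝ) :
    coarseSquare f K x ≤ maximalSquareFunction f x := by
  rw [maximalSquareFunction_eq, tsum_int_split _ K]
  exact ENNReal.rpow_le_rpow le_add_self (by norm_num)

lemma enorm_integral_le_of_ae_le {f : ℝ → 𝕜} {B : ℝ≥0∞} (hB : ∀ᵐ x, ‖f x‖ₑ ≤ B) (a b : ℝ) :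
    ‖∫ y in a..b, f y‖ₑ ≤ B * ENNReal.ofReal |b - a| := by
  rw [← enorm_norm, intervalIntegral.norm_intervalIntegral_eq, enorm_norm]
  refine (enorm_integral_le_lintegral_enorm _).trans ?_
  refine (lintegral_mono_ae (ae_restrict_of_ae hB)).trans_eq ?_
  rw [setLIntegral_const, Real.volume_uIoc]

/-- Both points share their cell at every coarser scale, so the dyadic mean cancels. Moving an
interval of length 2^(K+1+i) by at most 2^K changes its integral by at most 2B·2^K, which is
B·2^(-i) after normalization. -/
lemma scaleOsc_le_add {f : ℝ → 𝕜} (hf : ∀ a b, IntervalIntegrable f volume a b) {B : ℝ≥0∞}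
    (hB : ∀ᵐ x, ‖f x‖ₑ ≤ B) {K m : ℤ} {x x' : ℝ} (hx : x ∈ dyadicInterval K m)
    (hx' : x' ∈ dyadicInterval K m) (i : ℕ) :
    scaleOsc f (K + 1 + i) x ≤ scaleOsc f (K + 1 + i) x' + B * (2⁻¹) ^ i := by
  set k : ℤ := K + 1 + i with hk
  have h2k := two_zpow_pos k
  have h2K := two_zpow_pos K
  have hfloor : ⌊x / (2 : ℝ) ^ k⌋ = ⌊x' / (2 : ℝ) ^ k⌋ :=
    floor_eq_floor_of_le (k := K) (by omega)
      ((mem_dyadicInterval_iff.1 hx).trans (mem_dyadicInterval_iff.1 hx').symm)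
  have hdist : |x - x'| ≤ 2 ^ K := by
    rw [abs_le]
    constructor <;> linarith [hx.1, hx.2, hx'.1, hx'.2]
  have hki : (2 : ℝ) ^ k = 2 ^ K * (2 * 2 ^ i) := by
    rw [hk, zpow_add₀ (by norm_num), zpow_add_one₀ (by norm_num), zpow_natCast]; ring
  refine iSup₂_le fun r hr => ?_
  rw [hfloor]
  set h := (2 : ℝ) ^ k with hh
  have hle : ‖h⁻¹ • (∫ y in (x' + r)..(x' + r + h), f y) - cellMean f k ⌊x' / h⌋‖ₑ ≤
      scaleOsc f k x' := le_iSup₂_of_le r hr le_rfl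
  have hdiff : (∫ y in (x + r)..(x + r + h), f y) - (∫ y in (x' + r)..(x' + r + h), f y) =
      (∫ y in (x' + r + h)..(x + r + h), f y) - ∫ y in (x' + r)..(x + r), f y := by
    rw [intervalIntegral.integral_interval_sub_interval_comm (hf _ _) (hf _ _) (hf _ _),
      intervalIntegral.integral_symm (x' + r), intervalIntegral.integral_symm (x' + r + h)]
    abel
  have hdn : ‖h⁻¹ • ((∫ y in (x + r)..(x + r + h), f y) - ∫ y in (x' + r)..(x' + r + h), f y)‖ₑ ≤
      B * (2⁻¹) ^ i := by
    rw [hdiff, enorm_smul, Real.enorm_eq_ofReal (by positivity)]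
    have hb1 := enorm_integral_le_of_ae_le hB (x' + r + h) (x + r + h)
    have hb2 := enorm_integral_le_of_ae_le hB (x' + r) (x + r)
    rw [show x + r + h - (x' + r + h) = x - x' by ring] at hb1
    rw [show x + r - (x' + r) = x - x' by ring] at hb2
    have hd : ENNReal.ofReal |x - x'| ≤ ENNReal.ofReal (2 ^ K) := ENNReal.ofReal_le_ofReal hdist
    calc _ ≤ ENNReal.ofReal h⁻¹ * (B * ENNReal.ofReal (2 ^ K) + B * ENNReal.ofReal (2 ^ K)) := by
          gcongr
          exact enorm_sub_le.trans (add_le_add (hb1.trans (by gcongr)) (hb2.trans (by gcongr)))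
      _ = B * (ENNReal.ofReal h⁻¹ * ENNReal.ofReal (2 * 2 ^ K)) := by
          rw [ENNReal.ofReal_mul (by norm_num)]; simp; ring
      _ = B * ENNReal.ofReal ((2 : ℝ)⁻¹ ^ i) := by
          rw [← ENNReal.ofReal_mul (by positivity), hki]
          congr 2
          rw [inv_pow]
          field_simp
      _ = _ := by
          rw [ENNReal.ofReal_pow (by norm_num), ENNReal.ofReal_inv_of_pos (by norm_num)]
          simp
  calc _ = ‖(h⁻¹ • (∫ y in (x' + r)..(x' + r + h), f y) - cellMean f k ⌊x' / h⌋) +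
        h⁻¹ • ((∫ y in (x + r)..(x + r + h), f y) - ∫ y in (x' + r)..(x' + r + h), f y)‖ₑ := by
        congr 1; module
    _ ≤ _ := (enorm_add_le _ _).trans (add_le_add hle hdn)

/-- The coarse part of the square function oscillates boundedly on a dyadic interval. -/
lemma coarseSquare_le_add {f : ℝ → 𝕜} (hf : ∀ a b, IntervalIntegrable f volume a b) {B : ℝ≥0∞}
    (hB : ∀ᵐ x, ‖f x‖ₑ ≤ B) {K m : ℤ} {x x' : ℝ} (hx : x ∈ dyadicInterval K m)
    (hx' : x' ∈ dyadicInterval K m) :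
    coarseSquare f K x ≤ coarseSquare f K x' + 2 * B := by
  have hgeom : (∑' i : ℕ, (B * (2⁻¹) ^ i) ^ 2) ^ (1 / 2 : ℝ) ≤ 2 * B := by
    rw [one_div, ENNReal.rpow_inv_le_iff (by norm_num)]
    calc ∑' i : ℕ, (B * (2⁻¹) ^ i) ^ 2 ≤ ∑' i : ℕ, B ^ 2 * (2⁻¹) ^ i := by
          refine ENNReal.tsum_le_tsum fun i => ?_
          rw [mul_pow, ← pow_mul]
          gcongr 1
          exact pow_le_pow_right_of_le_one' (by simp) (by omega)
      _ = B ^ 2 * 2 := by rw [ENNReal.tsum_mul_left, ENNReal.tsum_geometric_two]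
      _ ≤ B ^ 2 * 4 := by gcongr; norm_num
      _ = (2 * B) ^ (2 : ℝ) := by
          rw [ENNReal.rpow_two]; ring
  refine le_trans (ENNReal.rpow_le_rpow (ENNReal.tsum_le_tsum fun i =>
    pow_le_pow_left' (scaleOsc_le_add hf hB hx hx' i) 2) (by norm_num)) ?_
  exact (sqrt_tsum_add_sq_le _ _).trans (add_le_add_right hgeom _)

lemma measurable_fineSquare {f : ℝ → 𝕜} (hf : ∀ a b, IntervalIntegrable f volume a b) (K : ℤ) :
    Measurable (fineSquare f K) :=
  (Measurable.tsum fun i : ℕ => (measurable_scaleOsc hf (K - i)).pow_const 2).pow_const _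

lemma sqrt_sq_eq (z : ℝ≥0∞) : (z ^ (1 / 2 : ℝ)) ^ 2 = z := by
  rw [← ENNReal.rpow_natCast, ← ENNReal.rpow_mul]; norm_num

lemma setLIntegral_fineSquare_sq_le {f : ℝ → 𝕜} (hf : ∀ a b, IntervalIntegrable f volume a b)
    (K m : ℤ) :
    ∫⁻ x in dyadicInterval K m, fineSquare f K x ^ 2 ≤
      444 * ∫⁻ y in Ico ((m - 1) * (2 : ℝ) ^ K) ((m + 2) * (2 : ℝ) ^ K), ‖f y‖ₑ ^ 2 := by
  have hmeas : ∀ i : ℕ, Measurable fun x : ℝ =>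
      cellOsc f (K - i) ⌊x / (2 : ℝ) ^ (K - (i : ℤ))⌋ ^ 2 := fun i =>
    measurable_comp_floor (K - i) (fun m => cellOsc f (K - i) m ^ 2)
  calc _ ≤ ∫⁻ x in dyadicInterval K m,
        ∑' i : ℕ, cellOsc f (K - i) ⌊x / (2 : ℝ) ^ (K - (i : ℤ))⌋ ^ 2 := by
        refine lintegral_mono fun x => ?_
        rw [fineSquare, sqrt_sq_eq]
        exact ENNReal.tsum_le_tsum fun i => pow_le_pow_left' (scaleOsc_le_cellOsc f _ x) 2
    _ = ⨆ n : ℕ, ∑ i ∈ Finset.range n, ∫⁻ x in dyadicInterval K m,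
        cellOsc f (K - i) ⌊x / (2 : ℝ) ^ (K - (i : ℤ))⌋ ^ 2 := by
        rw [lintegral_tsum fun i => (hmeas i).aemeasurable, ENNReal.tsum_eq_iSup_nat]
    _ ≤ _ := by
        refine iSup_le fun n => ?_
        rw [← lintegral_finsetSum _ fun i _ => hmeas i]
        have h := setLIntegral_sum_cellOsc_sq_le hf K m
          (s := (Finset.range n).image fun i : ℕ => K - (i : ℤ)) (by
            intro k hk
            obtain ⟨i, -, rfl⟩ := Finset.mem_image.1 hk
            omega)
        refine le_of_eq_of_le (lintegral_congr fun x => ?_) h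
        rw [Finset.sum_image (by intro i _ j _ h; simpa using h)]

lemma setLIntegral_fineSquare_le {f : ℝ → 𝕜} (hf : ∀ a b, IntervalIntegrable f volume a b)
    {B : ℝ≥0∞} (hB : ∀ᵐ x, ‖f x‖ₑ ≤ B) (K m : ℤ) :
    ∫⁻ x in dyadicInterval K m, fineSquare f K x ≤ 37 * B * scale K := by
  have h2K := two_zpow_pos K
  have hvol : volume (Ico ((m - 1) * (2 : ℝ) ^ K) ((m + 2) * (2 : ℝ) ^ K)) = 3 * scale K := by
    rw [Real.volume_Ico, show ((m : ℝ) + 2) * 2 ^ K - (m - 1) * 2 ^ K = 3 * 2 ^ K by ring,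
      ENNReal.ofReal_mul (by norm_num), scale]
    simp
  have h1 : (∫⁻ x in dyadicInterval K m, fineSquare f K x) ^ 2 ≤ (37 * B * scale K) ^ 2 := by
    calc _ ≤ scale K * ∫⁻ x in dyadicInterval K m, fineSquare f K x ^ 2 := by
          refine (sq_lintegral_le (measurable_fineSquare hf K).aemeasurable).trans_eq ?_
          rw [Measure.restrict_apply_univ, volume_dyadicInterval]
      _ ≤ scale K * (444 * (B ^ 2 * (3 * scale K))) := by
          refine mul_le_mul_right ((setLIntegral_fineSquare_sq_le hf K m).trans
            (mul_le_mul_right ?_ _)) _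
          rw [← hvol, ← setLIntegral_const]
          exact lintegral_mono_ae (ae_restrict_of_ae (hB.mono fun x hx => pow_le_pow_left' hx 2))
      _ = 1332 * (B * scale K) ^ 2 := by ring
      -- 1332 = 3·444 is rounded up to 37² = 1369.
      _ ≤ 1369 * (B * scale K) ^ 2 := by gcongr; norm_num
      _ = _ := by ring
  exact (ENNReal.pow_le_pow_left_iff two_ne_zero).1 h1

/-- For bounded `f` of compact support this yields finiteness almost everywhere and local
integrability; the BMO constant comes from the local bound instead. -/
lemma lintegral_maximalSquareFunction_sq_le {f : ℝ → 𝕜}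
    (hf : ∀ a b, IntervalIntegrable f volume a b) :
    ∫⁻ x, maximalSquareFunction f x ^ 2 ≤ 444 * ∫⁻ y, ‖f y‖ₑ ^ 2 := by
  have hmeas : ∀ k : ℤ, Measurable fun x : ℝ => cellOsc f k ⌊x / (2 : ℝ) ^ k⌋ ^ 2 := fun k =>
    measurable_comp_floor k (fun m => cellOsc f k m ^ 2)
  calc _ ≤ ∫⁻ x : ℝ, ∑' k : ℤ, cellOsc f k ⌊x / (2 : ℝ) ^ k⌋ ^ 2 := by
        refine lintegral_mono fun x => ?_
        rw [maximalSquareFunction_eq, sqrt_sq_eq]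
        exact ENNReal.tsum_le_tsum fun k => pow_le_pow_left' (scaleOsc_le_cellOsc f k x) 2
    _ ≤ _ := by
        rw [lintegral_tsum fun k => (hmeas k).aemeasurable, ENNReal.tsum_eq_iSup_sum]
        refine iSup_le fun s => le_of_eq_of_le (Finset.sum_congr rfl fun k _ => ?_)
          (sum_tsum_cellOsc_sq_le hf s)
        exact lintegral_comp_floor k (fun m => cellOsc f k m ^ 2)

/-- The mean oscillation is at most twice the mean distance to any constant. -/
lemma setLIntegral_enorm_sub_intervalMean_le {g : ℝ → ℝ} {Q : Set ℝ} (hg : IntegrableOn g Q)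
    (h0 : volume Q ≠ 0) (htop : volume Q ≠ ∞) (c : ℝ) :
    ∫⁻ x in Q, ‖g x - intervalMean Q g‖ₑ ≤ 2 * ∫⁻ x in Q, ‖g x - c‖ₑ := by
  have hreal : volume.real Q ≠ 0 := (measureReal_ne_zero_iff htop).2 h0
  have hmean : ‖c - intervalMean Q g‖ₑ * volume Q ≤ ∫⁻ x in Q, ‖g x - c‖ₑ := by
    have e : intervalMean Q g - c = (volume.real Q)⁻¹ • ∫ x in Q, (g x - c) := by
      rw [intervalMean, setAverage_eq, integral_sub hg (integrableOn_const htop),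
        setIntegral_const, smul_sub, inv_smul_smul₀ hreal]
    rw [← enorm_neg, neg_sub, e, enorm_smul, mul_right_comm]
    have e2 : ‖(volume.real Q)⁻¹‖ₑ * volume Q = 1 := by
      rw [Real.enorm_eq_ofReal (by positivity), ENNReal.ofReal_inv_of_pos (by positivity),
        ofReal_measureReal htop, ENNReal.inv_mul_cancel h0 htop]
    rw [e2, one_mul]
    exact enorm_integral_le_lintegral_enorm _
  calc _ ≤ ∫⁻ x in Q, (‖g x - c‖ₑ + ‖c - intervalMean Q g‖ₑ) := by
        refine lintegral_mono fun x => le_trans (le_of_eq ?_) (enorm_add_le _ _)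
        congr 1; ring
    _ = (∫⁻ x in Q, ‖g x - c‖ₑ) + ‖c - intervalMean Q g‖ₑ * volume Q := by
        rw [lintegral_add_right _ measurable_const, setLIntegral_const]
    _ ≤ _ := by rw [two_mul]; gcongr

lemma lintegral_enorm_sq_lt_top_of_memLinftyC {f : ℝ → 𝕜} (hf : MemLinftyC f) :
    ∫⁻ x, ‖f x‖ₑ ^ 2 < ∞ := by
  obtain ⟨hf, K, hK, hfK⟩ := hf
  have hB : ∀ᵐ x, ‖f x‖ₑ ≤ eLpNorm f ∞ volume := by
    rw [eLpNorm_exponent_top]; exact ae_le_eLpNormEssSup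
  calc ∫⁻ x, ‖f x‖ₑ ^ 2 ≤ ∫⁻ x, K.indicator (fun _ => eLpNorm f ∞ volume ^ 2) x := by
        refine lintegral_mono_ae ?_
        filter_upwards [hB, hfK] with x hx hxK
        by_cases h : x ∈ K
        · rw [indicator_of_mem h]; exact pow_le_pow_left' hx 2
        · simp [hxK h]
    _ = eLpNorm f ∞ volume ^ 2 * volume K := lintegral_indicator_const hK.measurableSet _
    _ < ∞ := ENNReal.mul_lt_top (ENNReal.pow_lt_top hf.2) hK.measure_lt_top

/-- The maximal square function maps `L^∞_c` into dyadic `BMO`. -/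
lemma memDyadicBMO_maximalSquareFunction {f : ℝ → 𝕜} (hf : MemLinftyC f) :
    (∀ᵐ x, maximalSquareFunction f x < ∞) ∧
      MemDyadicBMO (fun x => (maximalSquareFunction f x).toReal) ∧
      dyadicBMONorm (fun x => (maximalSquareFunction f x).toReal) ≤ 78 * eLpNorm f ∞ volume := by
  set B := eLpNorm f ∞ volume with hBdef
  have hB : ∀ᵐ x, ‖f x‖ₑ ≤ B := by
    rw [hBdef, eLpNorm_exponent_top]; exact ae_le_eLpNormEssSup
  have hfi := intervalIntegrable_of_memLp le_top hf.1
  have hSm := measurable_maximalSquareFunction hfi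
  have hS2 : ∫⁻ x, maximalSquareFunction f x ^ 2 < ∞ :=
    (lintegral_maximalSquareFunction_sq_le hfi).trans_lt
      (ENNReal.mul_lt_top (by norm_num) (lintegral_enorm_sq_lt_top_of_memLinftyC hf))
  have hfin : ∀ᵐ x, maximalSquareFunction f x < ∞ :=
    (ae_lt_top (hSm.pow_const 2) hS2.ne).mono fun x hx => by
      by_contra h
      rw [not_lt, top_le_iff] at h
      simp [h] at hx
  set g : ℝ → ℝ := fun x => (maximalSquareFunction f x).toReal with hg
  have hgL2 : MemLp g 2 volume := by
    refine ⟨hSm.ennreal_toReal.aestronglyMeasurable, ?_⟩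
    rw [eLpNorm_lt_top_iff_lintegral_rpow_enorm_lt_top two_ne_zero (by norm_num)]
    refine lt_of_le_of_lt (lintegral_mono fun x => ?_) hS2
    rw [ENNReal.toReal_ofNat, ENNReal.rpow_two, Real.enorm_eq_ofReal ENNReal.toReal_nonneg]
    exact pow_le_pow_left' ENNReal.ofReal_toReal_le 2
  have hgloc : LocallyIntegrable g volume := hgL2.locallyIntegrable (by norm_num)
  have hnorm : dyadicBMONorm g ≤ 78 * B := by
    refine iSup₂_le fun K m => ?_
    have hQ0 : volume (dyadicInterval K m) ≠ 0 := volume_dyadicInterval K m ▸ scale_ne_zero K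
    have hQt : volume (dyadicInterval K m) ≠ ∞ := volume_dyadicInterval K m ▸ scale_ne_top K
    have hgQ : IntegrableOn g (dyadicInterval K m) :=
      (hgloc.integrableOn_isCompact isCompact_Icc).mono_set Ico_subset_Icc_self
    -- The coarse part at one point serves as the comparison constant, so it must be finite there;
    -- such a point exists because the cell has positive measure.
    obtain ⟨x₀, hx₀, hSx₀⟩ : ∃ x₀ ∈ dyadicInterval K m, maximalSquareFunction f x₀ < ∞ := by
      by_contra! hcon
      exact hQ0 (measure_mono_null (fun x hx => not_lt.2 (hcon x hx)) (ae_iff.1 hfin))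
    have hH : coarseSquare f K x₀ ≠ ∞ := ((coarseSquare_le f K x₀).trans_lt hSx₀).ne
    have hpt : ∀ᵐ x, x ∈ dyadicInterval K m →
        ‖g x - (coarseSquare f K x₀).toReal‖ₑ ≤ fineSquare f K x + 2 * B := by
      filter_upwards [hfin] with x hx hxQ
      refine enorm_toReal_sub_toReal_le hx.ne hH ?_ ?_
      · calc _ ≤ fineSquare f K x + coarseSquare f K x := maximalSquareFunction_le_add f K x
          _ ≤ fineSquare f K x + (coarseSquare f K x₀ + 2 * B) := by
              gcongr; exact coarseSquare_le_add hfi hB hxQ hx₀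
          _ = _ := by ring
      · calc _ ≤ coarseSquare f K x + 2 * B := coarseSquare_le_add hfi hB hx₀ hxQ
          _ ≤ _ := by
              gcongr
              · exact coarseSquare_le f K x
              · exact le_add_self
    have hint : ∫⁻ x in dyadicInterval K m, ‖g x - (coarseSquare f K x₀).toReal‖ₑ ≤
        39 * B * scale K := by
      calc _ ≤ ∫⁻ x in dyadicInterval K m, (fineSquare f K x + 2 * B) :=
            setLIntegral_mono_ae' (measurableSet_dyadicInterval K m) hpt
        _ = (∫⁻ x in dyadicInterval K m, fineSquare f K x) + 2 * B * scale K := by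
            rw [lintegral_add_right _ measurable_const, setLIntegral_const,
              volume_dyadicInterval]
        _ ≤ 37 * B * scale K + 2 * B * scale K := by
            gcongr; exact setLIntegral_fineSquare_le hfi hB K m
        _ = _ := by ring
    -- 78 = 2·(37 + 2): the fine part, the variation of the coarse part, and the factor 2 for
    -- replacing the constant by the mean.
    calc _ ≤ (volume (dyadicInterval K m))⁻¹ * (2 * (39 * B * scale K)) := by
          gcongr
          exact (setLIntegral_enorm_sub_intervalMean_le hgQ hQ0 hQt _).trans
            (mul_le_mul_right hint 2)
      _ = 78 * B * ((scale K)⁻¹ * scale K) := by rw [volume_dyadicInterval]; ring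
      _ = 78 * B := by rw [ENNReal.inv_mul_cancel (scale_ne_zero K) (scale_ne_top K), mul_one]
  exact ⟨hfin, ⟨hgloc, hnorm.trans_lt (ENNReal.mul_lt_top (by norm_num) hf.1.2)⟩, hnorm⟩

end DyadicSquare


theorem theorem1p2 (𝕜 : Type*) [RCLike 𝕜] :
    (∃ C : ℝ≥0, ∀ f : ℝ → 𝕜, MemLinftyC f →
      (∀ᵐ x, maximalSquareFunction f x < ∞) ∧
      MemDyadicBMO (fun x => (maximalSquareFunction f x).toReal) ∧
      dyadicBMONorm (fun x => (maximalSquareFunction f x).toReal) ≤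
        C * eLpNorm f ∞ volume) ∧
    (∀ p : ℝ≥0∞, 2 < p → p < ∞ → ∃ C : ℝ≥0, ∀ f : ℝ → 𝕜, MemLp f p volume →
      MemLp (maximalSquareFunction f) p volume ∧
      eLpNorm (maximalSquareFunction f) p volume ≤ C * eLpNorm f p volume ∧
      ∀ I : ℤ → ℝ → Set ℝ, IsIntervalFamily I →
        (∀ x, familySquareFunction I f x ≤ maximalSquareFunction f x) ∧
        eLpNorm (familySquareFunction I f) p volume ≤ C * eLpNorm f p volume) := by
  refine ⟨⟨78, fun f hf => DyadicSquare.memDyadicBMO_maximalSquareFunction hf⟩,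
    fun p hp2 hp => ?_⟩
  obtain ⟨C, hC⟩ := DyadicSquare.exists_eLpNorm_maximalSquareFunction_le 𝕜 hp2 hp
  refine ⟨C, fun f hf => ⟨⟨?_, ?_⟩, hC f hf, fun I hI => ⟨?_, ?_⟩⟩⟩
  · exact (DyadicSquare.measurable_maximalSquareFunction (DyadicSquare.intervalIntegrable_of_memLp
      (le_trans (by norm_num) hp2.le) hf)).aestronglyMeasurable
  · exact (hC f hf).trans_lt (ENNReal.mul_lt_top ENNReal.coe_lt_top hf.2)
  · exact DyadicSquare.familySquareFunction_le hI f
  -- Monotonicity of the lower integral suffices, so an arbitrary, possibly non-measurable, choice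
  -- of intervals causes no difficulty.
  · exact (eLpNorm_mono_enorm fun x => by
      simpa using DyadicSquare.familySquareFunction_le hI f x).trans (hC f hf)
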